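/- Let $\mathbb T=\mathbb R/\mathbb Z$, $\mathbb N^*=\{1,2,\dots\}$ and $\mathrm e_z(\tau)=e^{-2\pi i z\tau}$ for $z\in\mathbb Z$, $\tau\in\mathbb T$. For an integer $m\ge 0$ and $\eta\in\mathbb Z^m$, let $v_\eta$ be the operator on $\ell^2((\mathbb N^*)^m)$ given by $(v_\eta f)(\xi)=f(\xi-\eta)$ if $\xi-\eta\in(\mathbb N^*)^m$ and $(v_\eta f)(\xi)=0$ otherwise (for $m=0$ the space is $\mathbb C$ and $v_0=1$). For $\rho\in\ell^1(\mathbb Z^m)$ put $$T^m_\rho=\sum_{\eta\in\mathbb Z^m}\rho(\eta)\,v_\eta,\qquad V^m_\rho=\sum_{\eta\in\mathbb Z^m}\rho(\eta)\,v_\eta v_\eta^*.$$ The essential spectrum $\sigma_{\rm ess}(A)$ of a bounded operator $A$ is the set of $z\in\mathbb C$ such that $A-z$ is not Fredholm (equivalently, the spectrum of the image of $A$ in the Calkin algebra). Let $N\ge1$. For $\rho\in\ell^1(\mathbb Z^N)$ and $\tau\in\mathbb T$ define $\mu(\tau)\rho\in\ell^1(\mathbb Z^{N-1})$ by $$[\mu(\tau)\rho](z_2,\dots,z_N)=\sum_{z_1\in\mathbb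 Z}\mathrm e_{z_1}(\tau)\,\rho(z_1,\,z_1+z_2,\,\dots,\,z_1+\dots+z_N),$$ and for $\varrho\in\ell^1(\mathbb Z^{N-1})$, a function of the variables $z_2,\dots,z_N$, and $j\in\{2,\dots,N\}$ define $\nu_j(\tau)\varrho\in\ell^1(\mathbb Z^{N-2})$ by $$[\nu_j(\tau)\varrho](z_2,\dots,z_{j-1},z_{j+1},\dots,z_N)=\sum_{z_j\in\mathbb Z}\mathrm e_{z_j}(\tau)\,\varrho(z_2,\dots,z_N).$$ **Theorem 4.2.** Let $\varphi,\psi\in\ell^1(\mathbb Z^N)$ be real functions and let $\tau\in\mathbb T$. The essential spectrum of the fiber Hamiltonian $H(\tau)=T^{N-1}_{\mu(\tau)\varphi}+V^{N-1}_{\mu(0)\psi}$ on $\ell^2((\mathbb N^*)^{N-1})$ is $$\sigma_{\rm ess}(H(\tau))=\bigcup_{j=2}^{N}\ \bigcup_{\tau'\in\mathbb T}\Sigma_j(\tau,\tau'),$$ where $\Sigma_j(\tau,\tau')$ is the spectrum of the operator $T^{N-2}_{\nu_j(\tau')\mu(\tau)\varphi}+V^{N-2}_{\nu_j(0)\mu(0)\psi}$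 on $\ell^2((\mathbb N^*)^{N-2})$. (For $N=1$ both sides are empty.) Moreover, in the Heisenberg case with $N=2$, that is, for $\varphi=-2a\chi_S$ and $\psi=2b\chi_S$ with $a,b\in\mathbb R$ and $S=\{(\pm1,0),(0,\pm1)\}$, one has for every $\tau\in\mathbb R$ $$\sigma_{\rm ess}(H(\tau))=\{8b-4a\cos(2\pi\tau')-4a\cos(2\pi(\tau-\tau')):\tau'\in[0,1]\}=\bigl[\,8b-8|a\cos(\pi\tau)|,\ 8b+8|a\cos(\pi\tau)|\,\bigr].$$ -/

import Mathlib

noncomputable section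

namespace MagnonToeplitz

open scoped Classical in
/-- `f(ξ - η)` if `ξ - η ∈ E`, and `0` otherwise, for `f : E → ℂ` and `ξ ∈ E`: the translate by `η`
of the extension of `f` by zero, restricted to `E`. -/
def shiftFun {X : Type*} [AddCommGroup X] (E : Set X) (η : X) (f : E → ℂ) : E → ℂ :=
  fun ξ => if h : (ξ : X) - η ∈ E then f ⟨(ξ : X) - η, h⟩ else 0

theorem shiftFun_add {X : Type*} [AddCommGroup X] (E : Set X) (η : X) (f g : E → ℂ) :
    shiftFun E η (f + g) = shiftFun E η f + shiftFun E η g := by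
  ext ξ
  by_cases h : (ξ : X) - η ∈ E <;> simp [shiftFun, h]

theorem shiftFun_smul {X : Type*} [AddCommGroup X] (E : Set X) (η : X) (c : ℂ) (f : E → ℂ) :
    shiftFun E η (c • f) = c • shiftFun E η f := by
  ext ξ
  by_cases h : (ξ : X) - η ∈ E <;> simp [shiftFun, h]

open scoped Classical in
theorem sum_shiftFun_le {X : Type*} [AddCommGroup X] (E : Set X) (η : X)
    (f : lp (fun _ : E => ℂ) 2) (s : Finset E) :
    ∑ ξ ∈ s, ‖shiftFun E η f ξ‖ ^ (2 : ENNReal).toReal ≤ ‖f‖ ^ (2 : ENNReal).toReal := by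
  have h2 : 0 < (2 : ENNReal).toReal := by norm_num
  set t : Finset E := s.filter (fun ξ => (ξ : X) - η ∈ E)
  have hm : ∀ ξ ∈ t, (ξ : X) - η ∈ E := fun ξ hξ => (Finset.mem_filter.1 hξ).2
  have h1 : ∑ ξ ∈ s, ‖shiftFun E η f ξ‖ ^ (2 : ENNReal).toReal
      = ∑ ξ ∈ t, ‖shiftFun E η f ξ‖ ^ (2 : ENNReal).toReal := by
    symm
    apply Finset.sum_subset (Finset.filter_subset _ _)
    intro x hx hxt
    have : ¬ ((x : X) - η ∈ E) := fun h => hxt (Finset.mem_filter.2 ⟨hx, h⟩)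
    simp [shiftFun, this]
  have h3 : ∑ ξ ∈ t.attach, ‖shiftFun E η f ξ‖ ^ (2 : ENNReal).toReal
      = ∑ y ∈ t.attach.image
          (fun ξ => (⟨(ξ.1 : X) - η, hm ξ.1 ξ.2⟩ : E)),
          ‖f y‖ ^ (2 : ENNReal).toReal := by
    rw [Finset.sum_image]
    · refine Finset.sum_congr rfl fun ξ _ => ?_
      have := hm ξ.1 ξ.2
      simp [shiftFun, this]
    · intro a _ b _ hab
      simp only [Subtype.mk.injEq, sub_left_inj] at hab
      exact Subtype.ext (Subtype.ext hab)
  rw [h1, ← Finset.sum_attach, h3]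
  exact lp.sum_rpow_le_norm_rpow h2 f _

/-- The partial isometry `v_η^E` in `ℓ²(E)`, that is, the compression to `ℓ²(E)` of the translation
`(u_η f)(ξ) = f(ξ - η)` in `ℓ²(X)`. -/
def shift {X : Type*} [AddCommGroup X] (E : Set X) (η : X) :
    lp (fun _ : E => ℂ) 2 →L[ℂ] lp (fun _ : E => ℂ) 2 :=
  LinearMap.mkContinuous
    { toFun := fun f => ⟨shiftFun E η f, memℓp_gen' (sum_shiftFun_le E η f)⟩
      map_add' := by
        intro f g
        exact Subtype.ext (shiftFun_add E η f g)
      map_smul' := by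
        intro c f
        exact Subtype.ext (shiftFun_smul E η c f) }
    1
    (by
      intro f
      rw [one_mul]
      exact lp.norm_le_of_forall_sum_le (by norm_num) (norm_nonneg f) (sum_shiftFun_le E η f))

/-- The Toeplitz operator `T_φ^E = ∑_η φ(η) v_η^E`, a norm convergent series for `φ ∈ ℓ¹(X)`. -/
def toeplitz {X : Type*} [AddCommGroup X] (E : Set X) (φ : X → ℂ) :
    lp (fun _ : E => ℂ) 2 →L[ℂ] lp (fun _ : E => ℂ) 2 :=
  ∑' η : X, φ η • shift E η

/-- The potential `V_ψ^E = ∑_η ψ(η) v_η^E (v_η^E)*`, a norm convergent series for `ψ ∈ ℓ¹(X)`. -/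
def potential {X : Type*} [AddCommGroup X] (E : Set X) (ψ : X → ℂ) :
    lp (fun _ : E => ℂ) 2 →L[ℂ] lp (fun _ : E => ℂ) 2 :=
  ∑' η : X, ψ η • (shift E η ∘L ContinuousLinearMap.adjoint (shift E η))

/-- The essential spectrum: all `z ∈ ℂ` such that `A - z` is not a Fredholm operator. -/
def essentialSpectrum {H : Type*} [NormedAddCommGroup H] [InnerProductSpace ℂ H]
    (A : H →L[ℂ] H) : Set ℂ :=
  {z | ¬ ContinuousLinearMap.IsFredholm (A - z • ContinuousLinearMap.id ℂ H)}

/-- The subset `(ℕ*)^ι` of the group `ℤ^ι`, where `ℕ* = {1, 2, …}`. -/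
def posOrthant (ι : Type*) : Set (ι → ℤ) := {z | ∀ i, 1 ≤ z i}

/-- `θ⁻¹(z₁, …, z_N) = (z₁, z₁ + z₂, …, z₁ + ⋯ + z_N)`, the inverse of the automorphism
`θ(y₁, …, y_N) = (y₁, y₂ - y₁, …, y_N - y_{N-1})` of `ℤ^N`. -/
def thetaInv {N : ℕ} (z : Fin N → ℤ) : Fin N → ℤ := fun k => ∑ i ∈ Finset.Iic k, z i

/-- `μ(τ)ρ`, for `N = n + 1`: the Fourier transform of `ρ ∘ θ⁻¹` in the first variable, at `τ`.
The torus is `ℝ / ℤ`, and `fourier (-z) τ = exp(-2πizτ)`. The index `i : Fin n` of the result stands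
for the variable number `i + 2`. -/
def mu {n : ℕ} (τ : UnitAddCircle) (ρ : (Fin (n + 1) → ℤ) → ℂ) : (Fin n → ℤ) → ℂ :=
  fun z => ∑' z₁ : ℤ, fourier (-z₁) τ * ρ (thetaInv (Fin.cons z₁ z))

/-- `ν_j(τ)ρ`: the Fourier transform of `ρ` in the variable `j`, at `τ`, as a function of the
remaining variables. -/
def nu {n : ℕ} (j : Fin n) (τ : UnitAddCircle) (ρ : (Fin n → ℤ) → ℂ) :
    ({i : Fin n // i ≠ j} → ℤ) → ℂ :=
  fun z => ∑' y : ℤ, fourier (-y) τ * ρ (fun i => if h : i = j then y else z ⟨i, h⟩)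

/-- The fiber Hamiltonian `H(τ) = T_{μ(τ)φ} + V_{μ(0)ψ}` in `ℓ²((ℕ*)^{N-1})`, for `N = n + 1`. -/
def fiber {n : ℕ} (φ ψ : (Fin (n + 1) → ℤ) → ℝ) (τ : UnitAddCircle) :
    lp (fun _ : posOrthant (Fin n) => ℂ) 2 →L[ℂ] lp (fun _ : posOrthant (Fin n) => ℂ) 2 :=
  toeplitz (posOrthant (Fin n)) (mu τ fun x => (φ x : ℂ))
    + potential (posOrthant (Fin n)) (mu 0 fun x => (ψ x : ℂ))

/-- The operator `T_{ν_j(τ')μ(τ)φ} + V_{ν_j(0)μ(0)ψ}` in `ℓ²((ℕ*)^{N-2})`, for `N = n + 1`. -/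
def reducedFiber {n : ℕ} (φ ψ : (Fin (n + 1) → ℤ) → ℝ) (j : Fin n) (τ τ' : UnitAddCircle) :
    lp (fun _ : posOrthant {i : Fin n // i ≠ j} => ℂ) 2 →L[ℂ]
      lp (fun _ : posOrthant {i : Fin n // i ≠ j} => ℂ) 2 :=
  toeplitz (posOrthant {i : Fin n // i ≠ j}) (nu j τ' (mu τ fun x => (φ x : ℂ)))
    + potential (posOrthant {i : Fin n // i ≠ j}) (nu j 0 (mu 0 fun x => (ψ x : ℂ)))

/-- The spectrum `Σ_j(τ, τ')` of the reduced operator. -/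
def reducedSpectrum {n : ℕ} (φ ψ : (Fin (n + 1) → ℤ) → ℝ) (j : Fin n) (τ τ' : UnitAddCircle) :
    Set ℂ :=
  spectrum ℂ (reducedFiber φ ψ j τ τ')

/-- The symmetric set `S` of generators of `ℤ^N`: plus or minus the vectors of the standard
basis. -/
def generators (N : ℕ) : Set (Fin N → ℤ) :=
  {x | ∃ i : Fin N, x = Pi.single i 1 ∨ x = Pi.single i (-1)}

end MagnonToeplitz

end

/-!
The essential spectrum is computed from a priori estimates, without the Calkin algebra.

An operator in `ℓ²` is Fredholm exactly when it and its adjoint are bounded below on the sequences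
that vanish on a suitable finite set (`isFredholm_iff_isBoundedBelowAtInfinity`), and it is
invertible exactly when it and its adjoint are bounded below (`isUnit_iff_isBoundedBelow`). Write
`H = T_ρ + V_ς` in `ℓ²((ℕ*)^ι)` and let `symbol j τ ρ ς` be the operator in `ℓ²((ℕ*)^{ι ∖ {j}})`
that arises when the variable number `j` is replaced by its frequency `τ`. It suffices to show that
`H` is bounded below at infinity if and only if all symbols are bounded below
(`isBoundedBelowAtInfinity_hamiltonian_iff`); applied to `H` and to its adjoint, whose symbols are
the adjoints of the symbols of `H`, this shows that `H` is Fredholm if and only if all its symbols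
are invertible. Replacing `ρ` by `ρ - z δ_0` replaces `H` by `H - z` and each symbol by the symbol
minus `z`, which gives the formula for the essential spectrum.

For the equivalence one may truncate `ρ` and `ς` to a finite set, with small errors in norm that are
uniform over all symbols. Then, at distance more than `R` from the face `ξ j = 1`, the operator `H`
is a block Toeplitz operator with respect to the layers `ξ j = x`.

* A lower bound of `H` far away is tested on plane waves in the variable `ξ j`, cut off to a long
  window; the boundary terms do not grow with the length of the window, so that the lower bound
  passes to the symbol (`IsLayering.lower_bound_blockSymbol`).
* Conversely, the Fourier transform in `ξ j` and Parseval's identity turn a lower bound of the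
  symbol, uniform in the frequency by compactness of the torus, into a lower bound of `H` on the
  sequences supported where `R < ξ j` (`IsLayering.lower_bound_of_blockSymbol`). The regions
  `R < ξ j` cover all but finitely many points, and the partition of unity
  `(ξ j - R)₊ / ∑ i, (ξ i - R)₊` is so slowly varying at infinity that its commutators with `H` are
  negligible there (`norm_le_of_lower_bound_symbolTerm`).

The reduced operators of the theorem are the symbols of the fiber Hamiltonian, by Fubini's theorem
for sums (`toeplitz_nu_add_potential_nu`). In the Heisenberg case with `N = 2` the symbols act on a
one-dimensional space, and they are evaluated directly.
-/

noncomputable section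

namespace MagnonToeplitz

/-! ### Block Toeplitz operators with finitely many diagonals -/

section BlockToeplitz

open AddCircle MeasureTheory

variable {H K κ α : Type*} [NormedAddCommGroup H] [InnerProductSpace ℂ H]
  [NormedAddCommGroup K] [InnerProductSpace ℂ K]

theorem inner_self_eq_ofReal_norm_sq (v : H) : inner ℂ v v = ((‖v‖ ^ 2 : ℝ) : ℂ) := by
  rw [inner_self_eq_norm_sq_to_K]
  push_cast
  rfl

/-- The maps `J x`, `x ≥ 1`, are isometric embeddings of `K` in `H` with pairwise orthogonal
ranges. Nothing is required of `J x` for `x ≤ 0`. -/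
def IsLayering (J : ℤ → K →L[ℂ] H) : Prop :=
  ∀ x y : ℤ, 1 ≤ x → 1 ≤ y → ∀ u w : K,
    inner ℂ (J x u) (J y w) = if x = y then inner ℂ u w else 0

theorem IsLayering.norm_apply {J : ℤ → K →L[ℂ] H} (hJ : IsLayering J) {x : ℤ} (hx : 1 ≤ x)
    (u : K) : ‖J x u‖ = ‖u‖ := by
  have h := hJ x x hx hx u u
  rw [if_pos rfl, inner_self_eq_ofReal_norm_sq, inner_self_eq_ofReal_norm_sq] at h
  have h' : ‖J x u‖ ^ 2 = ‖u‖ ^ 2 := by exact_mod_cast h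
  exact (sq_eq_sq₀ (norm_nonneg _) (norm_nonneg _)).1 h'

theorem norm_fourier_apply (n : ℤ) (τ : UnitAddCircle) : ‖(fourier n τ : ℂ)‖ = 1 := by
  rw [fourier_apply]
  exact Circle.norm_coe _

theorem integral_conj_fourier_mul_fourier (x y : ℤ) :
    ∫ τ : UnitAddCircle, starRingEnd ℂ (fourier (-x) τ) * fourier (-y) τ ∂haarAddCircle
      = if x = y then 1 else 0 := by
  have h := congrFun (fourierCoeff_fourier (T := 1) x) y
  rw [fourierCoeff, Pi.single_apply] at h
  simp only [eq_comm (a := y)] at h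
  rw [← h]
  refine integral_congr_ae (Filter.Eventually.of_forall fun τ => ?_)
  simp only [smul_eq_mul]
  rw [← fourier_neg, neg_neg, mul_comm]

/-- Parseval's identity for trigonometric polynomials with coefficients in a Hilbert space. The
frequencies `x k` need not be distinct. -/
theorem IsLayering.integral_norm_sq {J : ℤ → K →L[ℂ] H} (hJ : IsLayering J) (s : Finset κ)
    (x : κ → ℤ) (hx : ∀ k ∈ s, 1 ≤ x k) (u : κ → K) :
    ∫ τ : UnitAddCircle, ‖∑ k ∈ s, (fourier (-(x k)) τ : ℂ) • u k‖ ^ 2 ∂haarAddCircle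
      = ‖∑ k ∈ s, J (x k) (u k)‖ ^ 2 := by
  have key : ∀ τ : UnitAddCircle,
      ((‖∑ k ∈ s, (fourier (-(x k)) τ : ℂ) • u k‖ ^ 2 : ℝ) : ℂ)
        = ∑ k ∈ s, ∑ l ∈ s, inner ℂ (u k) (u l) *
            (starRingEnd ℂ (fourier (-(x k)) τ) * fourier (-(x l)) τ) := by
    intro τ
    rw [← inner_self_eq_ofReal_norm_sq, sum_inner]
    refine Finset.sum_congr rfl fun k _ => ?_
    rw [inner_sum]
    refine Finset.sum_congr rfl fun l _ => ?_
    rw [inner_smul_left, inner_smul_right]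
    ring
  have hint : ∀ k l, Integrable (fun τ : UnitAddCircle => inner ℂ (u k) (u l) *
      (starRingEnd ℂ (fourier (-(x k)) τ) * fourier (-(x l)) τ)) haarAddCircle := by
    intro k l
    apply Continuous.integrable_of_hasCompactSupport
    · fun_prop
    · exact HasCompactSupport.of_compactSpace _
  have : ((∫ τ : UnitAddCircle,
      ‖∑ k ∈ s, (fourier (-(x k)) τ : ℂ) • u k‖ ^ 2 ∂haarAddCircle : ℝ) : ℂ)
      = ((‖∑ k ∈ s, J (x k) (u k)‖ ^ 2 : ℝ) : ℂ) := by
    refine (integral_ofReal (𝕜 := ℂ)).symm.trans ?_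
    refine (integral_congr_ae (Filter.Eventually.of_forall key)).trans ?_
    rw [integral_finsetSum _ fun k _ => integrable_finsetSum _ fun l _ => hint k l]
    rw [← inner_self_eq_ofReal_norm_sq, sum_inner]
    refine Finset.sum_congr rfl fun k hk => ?_
    rw [integral_finsetSum _ fun l _ => hint k l, inner_sum]
    refine Finset.sum_congr rfl fun l hl => ?_
    rw [integral_const_mul, integral_conj_fourier_mul_fourier, hJ _ _ (hx k hk) (hx l hl)]
    split_ifs <;> simp
  exact_mod_cast this

/-- The symbol `τ ↦ ∑ k ∈ F, exp(-2πi (d k) τ) (a k)` of a block Toeplitz operator whose block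
`a k` maps the layer `x` to the layer `x + d k`. -/
def blockSymbol (F : Finset α) (d : α → ℤ) (a : α → K →L[ℂ] K) (τ : UnitAddCircle) : K →L[ℂ] K :=
  ∑ k ∈ F, (fourier (-(d k)) τ : ℂ) • a k

/-- A lower bound of the symbol is a lower bound of the operator away from the boundary: the
Fourier transform along the layers turns the operator into multiplication by its symbol. -/
theorem IsLayering.lower_bound_of_blockSymbol {J : ℤ → K →L[ℂ] H} (hJ : IsLayering J)
    {A : H →L[ℂ] H} {F : Finset α} {d : α → ℤ} {a : α → K →L[ℂ] K} {R : ℤ} (hR : 0 ≤ R)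
    (hd : ∀ k ∈ F, |d k| ≤ R)
    (hA : ∀ x, R < x → ∀ u, A (J x u) = ∑ k ∈ F, J (x + d k) (a k u)) {c : ℝ} (hc : 0 ≤ c)
    (hsym : ∀ τ u, c * ‖u‖ ≤ ‖blockSymbol F d a τ u‖)
    (s : Finset κ) (x : κ → ℤ) (hx : ∀ k ∈ s, R < x k) (u : κ → K) :
    c * ‖∑ k ∈ s, J (x k) (u k)‖ ≤ ‖A (∑ k ∈ s, J (x k) (u k))‖ := by
  have hx1 : ∀ k ∈ s, 1 ≤ x k := fun k hk => by have := hx k hk; omega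
  have hAh : A (∑ k ∈ s, J (x k) (u k))
      = ∑ p ∈ s ×ˢ F, J (x p.1 + d p.2) (a p.2 (u p.1)) := by
    rw [map_sum, Finset.sum_product]
    exact Finset.sum_congr rfl fun k hk => hA _ (hx k hk) _
  have hp : ∀ p ∈ s ×ˢ F, 1 ≤ x p.1 + d p.2 := by
    intro p hp
    rw [Finset.mem_product] at hp
    have h1 := hx _ hp.1
    have h2 := abs_le.1 (hd _ hp.2)
    omega
  have hsymb : ∀ τ : UnitAddCircle,
      ∑ p ∈ s ×ˢ F, (fourier (-(x p.1 + d p.2)) τ : ℂ) • a p.2 (u p.1)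
        = blockSymbol F d a τ (∑ k ∈ s, (fourier (-(x k)) τ : ℂ) • u k) := by
    intro τ
    rw [blockSymbol, map_sum, Finset.sum_product]
    refine Finset.sum_congr rfl fun k _ => ?_
    rw [sum_apply]
    refine Finset.sum_congr rfl fun l _ => ?_
    rw [neg_add, fourier_add, smul_apply, map_smul, smul_smul, mul_comm]
  have hsq : (c * ‖∑ k ∈ s, J (x k) (u k)‖) ^ 2 ≤ ‖A (∑ k ∈ s, J (x k) (u k))‖ ^ 2 := by
    rw [mul_pow, ← hJ.integral_norm_sq s x hx1 u, hAh,
      ← hJ.integral_norm_sq (s ×ˢ F) (fun p => x p.1 + d p.2) hp (fun p => a p.2 (u p.1)),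
      ← integral_const_mul]
    apply integral_mono
    · apply Continuous.integrable_of_hasCompactSupport (by fun_prop)
      exact HasCompactSupport.of_compactSpace _
    · apply Continuous.integrable_of_hasCompactSupport (by fun_prop)
      exact HasCompactSupport.of_compactSpace _
    · intro τ
      dsimp only
      rw [hsymb τ, ← mul_pow]
      exact pow_le_pow_left₀ (by positivity) (hsym τ _) 2
  exact le_of_sq_le_sq hsq (norm_nonneg _)

/-- The plane wave of frequency `τ` and amplitude `u`, cut off to the layers
`m, m + 1, …, m + L - 1`. -/
def planeWave (J : ℤ → K →L[ℂ] H) (τ : UnitAddCircle) (L : ℕ) (m : ℤ) (u : K) : H :=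
  ∑ i ∈ Finset.range L, (fourier (m + i) τ : ℂ) • J (m + i) u

theorem IsLayering.norm_planeWave_sq {J : ℤ → K →L[ℂ] H} (hJ : IsLayering J) (τ : UnitAddCircle)
    (L : ℕ) {m : ℤ} (hm : 1 ≤ m) (u : K) : ‖planeWave J τ L m u‖ ^ 2 = L * ‖u‖ ^ 2 := by
  have h := inner_self_eq_ofReal_norm_sq (planeWave J τ L m u)
  have h3 : inner ℂ (planeWave J τ L m u) (planeWave J τ L m u) = (L : ℂ) * ((‖u‖ ^ 2 : ℝ) : ℂ) := by
    rw [planeWave, sum_inner]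
    have : ∀ i ∈ Finset.range L, inner ℂ ((fourier (m + i) τ : ℂ) • J (m + i) u)
        (∑ i ∈ Finset.range L, (fourier (m + i) τ : ℂ) • J (m + i) u) = ((‖u‖ ^ 2 : ℝ) : ℂ) := by
      intro i hi
      rw [inner_sum, Finset.sum_eq_single i]
      · rw [inner_smul_left, inner_smul_right, hJ _ _ (by omega) (by omega), if_pos rfl,
          inner_self_eq_ofReal_norm_sq, ← mul_assoc, ← Complex.normSq_eq_conj_mul_self, Complex.normSq_eq_norm_sq, norm_fourier_apply]
        simp
      · intro l _ hli
        rw [inner_smul_left, inner_smul_right, hJ _ _ (by omega) (by omega), if_neg (by omega)]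
        simp
      · exact fun h => absurd hi h
    rw [Finset.sum_congr rfl this]
    simp
  rw [h3] at h
  exact_mod_cast h.symm

/-- Moving the window of a plane wave changes only boundary terms, whose number does not depend on
the length of the window. -/
theorem IsLayering.norm_planeWave_sub_le {J : ℤ → K →L[ℂ] H} (hJ : IsLayering J)
    (τ : UnitAddCircle) (L : ℕ) {m m' : ℤ} (hm : 1 ≤ m) (hm' : 1 ≤ m') (u : K) :
    ‖planeWave J τ L m' u - planeWave J τ L m u‖ ≤ 2 * |m' - m| * ‖u‖ := by
  have hstep : ∀ m : ℤ, 1 ≤ m →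
      ‖planeWave J τ L (m + 1) u - planeWave J τ L m u‖ ≤ 2 * ‖u‖ := by
    intro m hm
    have : planeWave J τ L (m + 1) u - planeWave J τ L m u
        = (fourier (m + L) τ : ℂ) • J (m + L) u - (fourier m τ : ℂ) • J m u := by
      rw [planeWave, planeWave, ← Finset.sum_sub_distrib]
      have := Finset.sum_range_sub (fun i : ℕ => (fourier (m + i) τ : ℂ) • J (m + i) u) L
      simp only [Nat.cast_zero, add_zero] at this
      rw [← this]
      refine Finset.sum_congr rfl fun i _ => ?_
      rw [show m + 1 + (i : ℤ) = m + ((i + 1 : ℕ) : ℤ) by push_cast; ring]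
    rw [this]
    refine (norm_sub_le _ _).trans ?_
    rw [norm_smul, norm_smul, norm_fourier_apply, norm_fourier_apply, hJ.norm_apply (by omega),
      hJ.norm_apply hm]
    linarith
  have hmain : ∀ (k : ℕ) (m : ℤ), 1 ≤ m →
      ‖planeWave J τ L (m + k) u - planeWave J τ L m u‖ ≤ 2 * k * ‖u‖ := by
    intro k m hm
    induction k with
    | zero => simp
    | succ k ih =>
      have h1 := hstep (m + k) (by omega)
      have h2 := norm_sub_le_norm_sub_add_norm_sub (planeWave J τ L (m + (k + 1 : ℕ)) u)
        (planeWave J τ L (m + k) u) (planeWave J τ L m u)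
      have h3 : m + ((k + 1 : ℕ) : ℤ) = m + k + 1 := by push_cast; ring
      rw [h3] at h2 ⊢
      push_cast
      linarith
  rcases le_total m m' with h | h
  · obtain ⟨k, hk⟩ := Int.le.dest h
    have := hmain k m hm
    rw [hk] at this
    have h4 : |m' - m| = k := by rw [← hk]; simp
    rw [h4]
    exact_mod_cast this
  · obtain ⟨k, hk⟩ := Int.le.dest h
    have := hmain k m' hm'
    rw [hk, norm_sub_rev] at this
    have h4 : |m' - m| = k := by rw [← hk]; simp
    rw [h4]
    exact_mod_cast this

/-- A lower bound of the operator on functions living on far away layers is a lower bound of the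
symbol: test the operator on long plane waves. -/
theorem IsLayering.lower_bound_blockSymbol {J : ℤ → K →L[ℂ] H} (hJ : IsLayering J)
    {A : H →L[ℂ] H} {F : Finset α} {d : α → ℤ} {a : α → K →L[ℂ] K} {R : ℤ} (hR : 0 ≤ R)
    (hd : ∀ k ∈ F, |d k| ≤ R)
    (hA : ∀ x, R < x → ∀ u, A (J x u) = ∑ k ∈ F, J (x + d k) (a k u)) {c : ℝ} {m : ℤ}
    (hm : R < m) (hlow : ∀ τ L u, c * ‖planeWave J τ L m u‖ ≤ ‖A (planeWave J τ L m u)‖)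
    (τ : UnitAddCircle) (u : K) : c * ‖u‖ ≤ ‖blockSymbol F d a τ u‖ := by
  have hm1 : 1 ≤ m := by omega
  -- `A` maps a plane wave to the plane wave of amplitude `blockSymbol F d a τ u`, up to an error
  -- bounded uniformly in the length of the window.
  have hAw : ∀ L, A (planeWave J τ L m u)
      = ∑ k ∈ F, (fourier (-(d k)) τ : ℂ) • planeWave J τ L (m + d k) (a k u) := by
    intro L
    rw [planeWave, map_sum]
    simp only [planeWave, Finset.smul_sum]
    rw [Finset.sum_comm]
    refine Finset.sum_congr rfl fun i _ => ?_
    rw [map_smul, hA _ (by omega), Finset.smul_sum]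
    refine Finset.sum_congr rfl fun k _ => ?_
    rw [smul_smul, ← fourier_add, show -d k + (m + d k + (i : ℤ)) = m + i by ring,
      show m + d k + (i : ℤ) = m + i + d k by ring]
  have hsw : ∀ L, planeWave J τ L m (blockSymbol F d a τ u)
      = ∑ k ∈ F, (fourier (-(d k)) τ : ℂ) • planeWave J τ L m (a k u) := by
    intro L
    simp only [planeWave, blockSymbol, Finset.smul_sum, sum_apply, map_sum,
      smul_apply, map_smul]
    rw [Finset.sum_comm]
    refine Finset.sum_congr rfl fun k _ => Finset.sum_congr rfl fun i _ => ?_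
    rw [smul_comm]
  set C : ℝ := ∑ k ∈ F, 2 * |d k| * ‖a k u‖ with hC
  have herr : ∀ L, ‖A (planeWave J τ L m u) - planeWave J τ L m (blockSymbol F d a τ u)‖ ≤ C := by
    intro L
    rw [hAw, hsw, ← Finset.sum_sub_distrib]
    refine norm_sum_le_of_le _ fun k hk => ?_
    rw [← smul_sub, norm_smul, norm_fourier_apply, one_mul]
    have h2 := abs_le.1 (hd k hk)
    have := hJ.norm_planeWave_sub_le τ L (m := m) (m' := m + d k) hm1 (by omega) (a k u)
    simpa using this
  have hnorm : ∀ (L : ℕ) (w : K), ‖planeWave J τ L m w‖ = Real.sqrt L * ‖w‖ := by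
    intro L w
    have := hJ.norm_planeWave_sq τ L hm1 w
    rw [← Real.sqrt_sq (norm_nonneg (planeWave J τ L m w)), this, Real.sqrt_mul (by positivity),
      Real.sqrt_sq (norm_nonneg _)]
  by_contra! hlt
  set δ := c * ‖u‖ - ‖blockSymbol F d a τ u‖ with hδ
  have hδ0 : 0 < δ := by linarith
  obtain ⟨n, hn⟩ := exists_nat_gt (C / δ)
  have h1 := hlow τ (n ^ 2) u
  have h2 := herr (n ^ 2)
  have h3 := norm_le_norm_add_norm_sub' (A (planeWave J τ (n ^ 2) m u))
    (planeWave J τ (n ^ 2) m (blockSymbol F d a τ u))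
  rw [hnorm] at h1 h3
  have h4 : Real.sqrt ((n ^ 2 : ℕ) : ℝ) = n := by
    push_cast
    exact Real.sqrt_sq (by positivity)
  rw [h4] at h1 h3
  rw [div_lt_iff₀ hδ0] at hn
  have h5 : (n : ℝ) * δ = c * (n * ‖u‖) - n * ‖blockSymbol F d a τ u‖ := by rw [hδ]; ring
  linarith

end BlockToeplitz

/-! ### Invertibility and the Fredholm property as lower bounds -/

section LowerBounds

open ContinuousLinearMap

/-- `‖A f‖ ≥ c ‖f‖` for some `c > 0` and all `f`. -/
def IsBoundedBelow {V W : Type*} [NormedAddCommGroup V] [NormedSpace ℂ V] [NormedAddCommGroup W]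
    [NormedSpace ℂ W] (A : V →L[ℂ] W) : Prop :=
  ∃ c : ℝ, 0 < c ∧ ∀ f, c * ‖f‖ ≤ ‖A f‖

theorem IsBoundedBelow.exists_antilipschitz {V W : Type*} [NormedAddCommGroup V] [NormedSpace ℂ V]
    [NormedAddCommGroup W] [NormedSpace ℂ W] {A : V →L[ℂ] W} (hA : IsBoundedBelow A) :
    ∃ K, AntilipschitzWith K A := by
  obtain ⟨c, hc, h⟩ := hA
  refine ⟨(⟨c, hc.le⟩ : NNReal)⁻¹, A.antilipschitz_of_bound fun x => ?_⟩
  have := h x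
  change ‖x‖ ≤ c⁻¹ * ‖A x‖
  rw [inv_mul_eq_div, le_div_iff₀ hc]
  linarith

theorem isBoundedBelow_of_isUnit {V : Type*} [NormedAddCommGroup V] [NormedSpace ℂ V]
    {A : V →L[ℂ] V} (h : IsUnit A) : IsBoundedBelow A := by
  obtain ⟨B, hB⟩ := h.exists_left_inv
  refine ⟨(‖B‖ + 1)⁻¹, by positivity, fun f => ?_⟩
  rw [inv_mul_le_iff₀ (by positivity)]
  have h1 : f = B (A f) := (DFunLike.congr_fun hB f).symm
  have h2 := B.le_opNorm (A f)
  rw [← h1] at h2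
  nlinarith [norm_nonneg (A f)]

section Hilbert

variable {V : Type*} [NormedAddCommGroup V] [InnerProductSpace ℂ V] [CompleteSpace V]

theorem isUnit_iff_isBoundedBelow {A : V →L[ℂ] V} :
    IsUnit A ↔ IsBoundedBelow A ∧ IsBoundedBelow (adjoint A) := by
  refine ⟨fun h => ⟨isBoundedBelow_of_isUnit h, isBoundedBelow_of_isUnit ?_⟩, fun ⟨h1, h2⟩ => ?_⟩
  · rw [← star_eq_adjoint]
    exact h.star
  · rw [ContinuousLinearMap.isUnit_iff_bijective]
    obtain ⟨K, hK⟩ := h1.exists_antilipschitz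
    refine ⟨hK.injective, ?_⟩
    have hcl : IsClosed (A.range : Set V) := by
      rw [LinearMap.coe_range]
      exact hK.isClosed_range A.uniformContinuous
    obtain ⟨K', hK'⟩ := h2.exists_antilipschitz
    have hker : (adjoint A).ker = ⊥ := LinearMap.ker_eq_bot.2 hK'.injective
    rw [← orthogonal_range] at hker
    have : CompleteSpace A.range := hcl.completeSpace_coe
    rw [Submodule.orthogonal_eq_bot_iff] at hker
    exact LinearMap.range_eq_top.1 hker

/-- A bounded operator of finite rank is a finite sum of operators of rank one. -/
theorem exists_sum_inner_smul_of_hasFiniteRange (F : V →L[ℂ] V)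
    (hF : (F : V →ₗ[ℂ] V).HasFiniteRange) :
    ∃ (m : ℕ) (a b : Fin m → V), ∀ x, F x = ∑ i, inner ℂ (a i) x • b i := by
  have hfd : FiniteDimensional ℂ F.range :=
    Module.Finite.of_fg (LinearMap.hasFiniteRange_iff_range.1 hF)
  set e := stdOrthonormalBasis ℂ F.range
  refine ⟨_, fun i => adjoint F (e i), fun i => (e i : V), fun x => ?_⟩
  have h := congrArg Subtype.val (e.sum_repr' ⟨F x, LinearMap.mem_range_self _ x⟩)
  simp only [Submodule.coe_sum, Submodule.coe_smul] at h
  rw [← h]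
  refine Finset.sum_congr rfl fun i _ => ?_
  rw [adjoint_inner_left]
  rfl

theorem adjoint_apply_eq_sum_inner_smul {F : V →L[ℂ] V} {m : ℕ} {a b : Fin m → V}
    (h : ∀ x, F x = ∑ i, inner ℂ (a i) x • b i) (x : V) :
    adjoint F x = ∑ i, inner ℂ (b i) x • a i := by
  refine ext_inner_right ℂ fun y => ?_
  rw [adjoint_inner_left, h, inner_sum, sum_inner]
  refine Finset.sum_congr rfl fun i _ => ?_
  rw [inner_smul_left, inner_smul_right, inner_conj_symm, mul_comm]

end Hilbert

section Sequences

variable {β : Type*}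

/-- A lower bound `‖A f‖ ≥ c ‖f‖`, `c > 0`, for all `f` that vanish on a suitable finite set. -/
def IsBoundedBelowAtInfinity (A : lp (fun _ : β => ℂ) 2 →L[ℂ] lp (fun _ : β => ℂ) 2) : Prop :=
  ∃ c : ℝ, 0 < c ∧ ∃ S : Finset β, ∀ f : lp (fun _ : β => ℂ) 2, (∀ ξ ∈ S, f ξ = 0) →
    c * ‖f‖ ≤ ‖A f‖

theorem exists_finset_norm_inner_le (y : lp (fun _ : β => ℂ) 2) {ε : ℝ} (hε : 0 < ε) :
    ∃ S : Finset β, ∀ f : lp (fun _ : β => ℂ) 2, (∀ ξ ∈ S, f ξ = 0) →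
      ‖inner ℂ y f‖ ≤ ε * ‖f‖ := by
  classical
  have h := lp.hasSum_single (p := 2) (by norm_num) y
  obtain ⟨S, hS⟩ := (h.eventually (Metric.ball_mem_nhds y hε)).exists
  refine ⟨S, fun f hf => ?_⟩
  set g := ∑ i ∈ S, lp.single 2 i (y i) with hg
  have h0 : inner ℂ g f = 0 := by
    rw [hg, sum_inner]
    refine Finset.sum_eq_zero fun ξ hξ => ?_
    rw [lp.inner_single_left, hf ξ hξ, inner_zero_right]
  have h1 : inner ℂ y f = inner ℂ (y - g) f := by rw [inner_sub_left, h0, sub_zero]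
  rw [h1]
  refine (norm_inner_le_norm _ _).trans (mul_le_mul_of_nonneg_right ?_ (norm_nonneg _))
  rw [norm_sub_rev, ← dist_eq_norm]
  exact (Metric.mem_ball.1 hS).le

theorem exists_finset_norm_sum_inner_smul_le {m : ℕ} (a b : Fin m → lp (fun _ : β => ℂ) 2) {ε : ℝ}
    (hε : 0 < ε) :
    ∃ S : Finset β, ∀ f : lp (fun _ : β => ℂ) 2, (∀ ξ ∈ S, f ξ = 0) →
      ‖∑ i, inner ℂ (a i) f • b i‖ ≤ ε * ‖f‖ := by
  classical
  set M : ℝ := ∑ i, ‖b i‖ with hM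
  have hM0 : 0 ≤ M := Finset.sum_nonneg fun i _ => norm_nonneg _
  choose S hS using fun i => exists_finset_norm_inner_le (a i) (ε := ε / (M + 1)) (by positivity)
  refine ⟨Finset.univ.biUnion S, fun f hf => ?_⟩
  have h1 : ∀ i, ‖inner ℂ (a i) f • b i‖ ≤ ε / (M + 1) * ‖f‖ * ‖b i‖ := by
    intro i
    rw [norm_smul]
    exact mul_le_mul_of_nonneg_right (hS i f fun ξ hξ =>
      hf ξ (Finset.mem_biUnion.2 ⟨i, Finset.mem_univ _, hξ⟩)) (norm_nonneg _)
  refine (norm_sum_le_of_le _ fun i _ => h1 i).trans ?_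
  rw [← Finset.mul_sum, ← hM]
  have h2 : ε / (M + 1) * M ≤ ε := by
    rw [div_mul_eq_mul_div, div_le_iff₀ (by positivity)]
    nlinarith
  nlinarith [mul_le_mul_of_nonneg_right h2 (norm_nonneg f)]

/-- A left parametrix modulo operators of finite rank gives a lower bound at infinity. -/
theorem isBoundedBelowAtInfinity_of_comp {A B : lp (fun _ : β => ℂ) 2 →L[ℂ] lp (fun _ : β => ℂ) 2}
    {m : ℕ} {a b : Fin m → lp (fun _ : β => ℂ) 2}
    (h : ∀ f, B (A f) = f + ∑ i, inner ℂ (a i) f • b i) : IsBoundedBelowAtInfinity A := by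
  obtain ⟨S, hS⟩ := exists_finset_norm_sum_inner_smul_le a b (ε := 1 / 2) (by norm_num)
  refine ⟨(2 * (‖B‖ + 1))⁻¹, by positivity, S, fun f hf => ?_⟩
  rw [inv_mul_le_iff₀ (by positivity)]
  have h1 := hS f hf
  have h2 := B.le_opNorm (A f)
  rw [h] at h2
  have h3 := norm_sub_le (f + ∑ i, inner ℂ (a i) f • b i) (∑ i, inner ℂ (a i) f • b i)
  rw [add_sub_cancel_right] at h3
  nlinarith [norm_nonneg (A f)]

/-- The closed subspace of finite codimension of all `f` that vanish on a given finite set. -/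
def vanishingOn (S : Finset β) : Submodule ℂ (lp (fun _ : β => ℂ) 2) :=
  (ContinuousLinearMap.pi fun ξ : S => lp.evalCLM ℂ (fun _ : β => ℂ) 2 (ξ : β)).ker

theorem mem_vanishingOn {S : Finset β} {f : lp (fun _ : β => ℂ) 2} :
    f ∈ vanishingOn S ↔ ∀ ξ ∈ S, f ξ = 0 := by
  rw [vanishingOn, LinearMap.mem_ker]
  constructor
  · intro h ξ hξ
    exact congrFun h ⟨ξ, hξ⟩
  · intro h
    funext ξ
    exact h ξ ξ.2

theorem isClosed_vanishingOn (S : Finset β) :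
    IsClosed (vanishingOn S : Set (lp (fun _ : β => ℂ) 2)) :=
  ContinuousLinearMap.isClosed_ker _

theorem coFG_vanishingOn (S : Finset β) : (vanishingOn S).CoFG :=
  Submodule.CoFG.ker _

theorem finiteDimensional_ker_of_isBoundedBelowAtInfinity
    {A : lp (fun _ : β => ℂ) 2 →L[ℂ] lp (fun _ : β => ℂ) 2} (hA : IsBoundedBelowAtInfinity A) :
    FiniteDimensional ℂ A.ker := by
  obtain ⟨c, hc, S, h⟩ := hA
  have : Disjoint (vanishingOn S) A.ker := by
    rw [Submodule.disjoint_def]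
    intro f hf hf'
    have h1 := h f (mem_vanishingOn.1 hf)
    rw [show A f = 0 from hf', norm_zero] at h1
    rw [← norm_le_zero_iff]
    by_contra! h2
    nlinarith
  rw [← Submodule.fg_iff_finiteDimensional]
  exact (coFG_vanishingOn S).fg_of_disjoint this.symm

/-- An operator in `ℓ²` is Fredholm if and only if it and its adjoint are bounded below on the
sequences that vanish on some finite set. -/
theorem isFredholm_iff_isBoundedBelowAtInfinity
    {A : lp (fun _ : β => ℂ) 2 →L[ℂ] lp (fun _ : β => ℂ) 2} :
    A.IsFredholm ↔ IsBoundedBelowAtInfinity A ∧ IsBoundedBelowAtInfinity (adjoint A) := by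
  constructor
  · intro h
    obtain ⟨B, hB1, hB2⟩ := h.exists_isQuasiInverse
    have h1 : ((B ∘L A - ContinuousLinearMap.id ℂ _ :) :
        lp (fun _ : β => ℂ) 2 →ₗ[ℂ] lp (fun _ : β => ℂ) 2).HasFiniteRange :=
      LinearMap.FiniteRangeSetoid.equiv_iff_hasFiniteRange.1 hB1
    have h2 : ((A ∘L B - ContinuousLinearMap.id ℂ _ :) :
        lp (fun _ : β => ℂ) 2 →ₗ[ℂ] lp (fun _ : β => ℂ) 2).HasFiniteRange :=
      LinearMap.FiniteRangeSetoid.equiv_iff_hasFiniteRange.1 hB2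
    constructor
    · obtain ⟨m, a, b, hab⟩ := exists_sum_inner_smul_of_hasFiniteRange _ h1
      refine isBoundedBelowAtInfinity_of_comp (B := B) (a := a) (b := b) fun f => ?_
      rw [← hab]
      simp
    · obtain ⟨m, a, b, hab⟩ := exists_sum_inner_smul_of_hasFiniteRange _ h2
      have hab' := adjoint_apply_eq_sum_inner_smul hab
      refine isBoundedBelowAtInfinity_of_comp (B := adjoint B) (a := b) (b := a) fun f => ?_
      rw [← hab', map_sub, adjoint_comp]
      simp [adjoint_id]
  · rintro ⟨h1, h2⟩
    have hker := finiteDimensional_ker_of_isBoundedBelowAtInfinity h1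
    have hker' := finiteDimensional_ker_of_isBoundedBelowAtInfinity h2
    obtain ⟨c, hc, S, h⟩ := h1
    have hcl := isClosed_vanishingOn S
    have hcofg := coFG_vanishingOn S
    have : CompleteSpace (vanishingOn S) := hcl.completeSpace_coe
    have hbb : IsBoundedBelow (A.domRestrict (vanishingOn S)) :=
      ⟨c, hc, fun f => h f (mem_vanishingOn.1 f.2)⟩
    obtain ⟨K, hK⟩ := hbb.exists_antilipschitz
    have hemb := hK.isClosedEmbedding (A.domRestrict (vanishingOn S)).uniformContinuous
    obtain ⟨hstrict, hrange⟩ := (A.isStrictMap_isClosed_range_iff_restrict (vanishingOn S) hcl).2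
      ⟨hemb.isEmbedding.isStrictMap, by rw [LinearMap.coe_range]; exact hemb.isClosed_range⟩
    refine ⟨hstrict, hrange, hker, ?_, Submodule.ClosedComplemented.of_finiteDimensional _⟩
    have : CompleteSpace A.range := hrange.completeSpace_coe
    rw [← orthogonal_range] at hker'
    exact (Submodule.fg_iff_finiteDimensional _ |>.2 hker').cofg_of_isCompl
      (Submodule.isCompl_orthogonal A.range).symm

end Sequences

end LowerBounds

/-! ### Translations, multiplications and layers -/

section Shift

open ContinuousLinearMap

variable {X : Type*} [AddCommGroup X] {E : Set X}

theorem norm_shift_le (η : X) : ‖shift E η‖ ≤ 1 :=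
  LinearMap.mkContinuous_norm_le _ zero_le_one _

theorem shift_apply_of_mem {η : X} {ξ : E} (h : (ξ : X) - η ∈ E) (f : lp (fun _ : E => ℂ) 2) :
    shift E η f ξ = f ⟨(ξ : X) - η, h⟩ :=
  dif_pos h

theorem shift_apply_of_notMem {η : X} {ξ : E} (h : (ξ : X) - η ∉ E)
    (f : lp (fun _ : E => ℂ) 2) : shift E η f ξ = 0 :=
  dif_neg h

theorem shift_zero : shift E 0 = ContinuousLinearMap.id ℂ (lp (fun _ : E => ℂ) 2) := by
  ext f ξ
  have h : (ξ : X) - 0 ∈ E := by rw [sub_zero]; exact ξ.2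
  rw [shift_apply_of_mem h]
  simp

theorem adjoint_shift (η : X) : adjoint (shift E η) = shift E (-η) := by
  classical
  refine ((ContinuousLinearMap.eq_adjoint_iff _ _).2 fun f g => ?_).symm
  rw [lp.inner_eq_tsum, lp.inner_eq_tsum]
  -- Both sides are sums over all `ξ ∈ E` with `ξ + η ∈ E`, up to translation by `η`.
  let F : X → ℂ := fun z => if h : z ∈ E ∧ z + η ∈ E then
    inner ℂ (f ⟨z + η, h.2⟩) (g ⟨z, h.1⟩) else 0
  have h1 : ∀ ξ : E, inner ℂ (shift E (-η) f ξ) (g ξ) = F ξ := by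
    intro ξ
    by_cases h : (ξ : X) + η ∈ E
    · rw [shift_apply_of_mem (by rwa [sub_neg_eq_add])]
      simp only [F, dif_pos (And.intro ξ.2 h), sub_neg_eq_add]
    · rw [shift_apply_of_notMem (by rwa [sub_neg_eq_add])]
      simp only [F, inner_zero_left]
      rw [dif_neg fun h' => h h'.2]
  have h2 : ∀ ξ : E, inner ℂ (f ξ) (shift E η g ξ) = F ((ξ : X) - η) := by
    intro ξ
    by_cases h : (ξ : X) - η ∈ E
    · rw [shift_apply_of_mem h]
      simp only [F]
      rw [dif_pos ⟨h, by rw [sub_add_cancel]; exact ξ.2⟩]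
      simp only [sub_add_cancel]
    · rw [shift_apply_of_notMem h, inner_zero_right]
      simp only [F]
      rw [dif_neg fun h' => h h'.1]
  rw [tsum_congr h1, tsum_congr h2, tsum_subtype E F, tsum_subtype E (fun z => F (z - η)),
    Set.indicator_eq_self.2, Set.indicator_eq_self.2, ← (Equiv.subRight η).tsum_eq F]
  · rfl
  · intro z hz
    by_contra hzE
    exact hz (dif_neg fun h' => hzE (by rw [← sub_add_cancel z η]; exact h'.2))
  · intro z hz
    by_contra hzE
    exact hz (dif_neg fun h' => hzE h'.1)

/-- The projection `v_η v_η*`: multiplication by the indicator function of `E ∩ (E + η)`. -/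
def shiftProj (E : Set X) (η : X) : lp (fun _ : E => ℂ) 2 →L[ℂ] lp (fun _ : E => ℂ) 2 :=
  shift E η ∘L adjoint (shift E η)

theorem norm_shiftProj_le (η : X) : ‖shiftProj E η‖ ≤ 1 := by
  refine (opNorm_comp_le _ _).trans ?_
  rw [LinearIsometryEquiv.norm_map]
  exact mul_le_one₀ (norm_shift_le η) (norm_nonneg _) (norm_shift_le η)

theorem adjoint_shiftProj (η : X) : adjoint (shiftProj E η) = shiftProj E η := by
  rw [shiftProj, adjoint_comp, adjoint_adjoint]

open scoped Classical in
theorem shiftProj_apply (η : X) (f : lp (fun _ : E => ℂ) 2) (ξ : E) :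
    shiftProj E η f ξ = if (ξ : X) - η ∈ E then f ξ else 0 := by
  rw [shiftProj, adjoint_shift, comp_apply]
  split_ifs with h
  · rw [shift_apply_of_mem h, shift_apply_of_mem (by simp)]
    simp
  · exact shift_apply_of_notMem h _

end Shift

section Multiplication

variable {β : Type*}

/-- Multiplication by a real function bounded by `1`. -/
def mulOp (χ : β → ℝ) (hχ : ∀ ξ, |χ ξ| ≤ 1) :
    lp (fun _ : β => ℂ) 2 →L[ℂ] lp (fun _ : β => ℂ) 2 :=
  LinearMap.mkContinuous
    { toFun := fun f => ⟨fun ξ => (χ ξ : ℂ) * f ξ, (lp.memℓp f).mono' fun ξ => by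
        rw [norm_mul, Complex.norm_real, Real.norm_eq_abs]
        exact mul_le_of_le_one_left (norm_nonneg _) (hχ ξ)⟩
      map_add' := fun f g => by
        ext ξ
        exact mul_add _ _ _
      map_smul' := fun c f => by
        ext ξ
        exact mul_left_comm _ _ _ }
    1
    (fun f => by
      rw [one_mul]
      refine lp.norm_mono (by norm_num) fun ξ => ?_
      change ‖(χ ξ : ℂ) * f ξ‖ ≤ ‖f ξ‖
      rw [norm_mul, Complex.norm_real, Real.norm_eq_abs]
      exact mul_le_of_le_one_left (norm_nonneg _) (hχ ξ))

theorem mulOp_apply (χ : β → ℝ) (hχ : ∀ ξ, |χ ξ| ≤ 1) (f : lp (fun _ : β => ℂ) 2) (ξ : β) :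
    mulOp χ hχ f ξ = χ ξ * f ξ :=
  rfl

theorem norm_mulOp_le (χ : β → ℝ) (hχ : ∀ ξ, |χ ξ| ≤ 1) : ‖mulOp χ hχ‖ ≤ 1 :=
  LinearMap.mkContinuous_norm_le _ zero_le_one _

end Multiplication

section Layer

variable {ι : Type*} [DecidableEq ι]

/-- The point of `ℤ^ι` with `j`-th coordinate `x` and remaining coordinates `z`. -/
def insertCoord (j : ι) (x : ℤ) (z : {i // i ≠ j} → ℤ) : ι → ℤ :=
  fun i => if h : i = j then x else z ⟨i, h⟩

/-- The point of `ℤ^ι` without its `j`-th coordinate. -/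
def dropCoord (j : ι) (ξ : ι → ℤ) : {i // i ≠ j} → ℤ := fun i => ξ i

@[simp]
theorem insertCoord_self (j : ι) (x : ℤ) (z : {i // i ≠ j} → ℤ) : insertCoord j x z j = x :=
  dif_pos rfl

@[simp]
theorem dropCoord_insertCoord (j : ι) (x : ℤ) (z : {i // i ≠ j} → ℤ) :
    dropCoord j (insertCoord j x z) = z := by
  funext i
  exact dif_neg i.2

@[simp]
theorem insertCoord_dropCoord (j : ι) (ξ : ι → ℤ) : insertCoord j (ξ j) (dropCoord j ξ) = ξ := by
  funext i
  by_cases h : i = j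
  · subst h
    exact dif_pos rfl
  · exact dif_neg h

theorem eq_of_dropCoord_eq {j : ι} {ξ ζ : ι → ℤ} (h : ξ j = ζ j)
    (h' : dropCoord j ξ = dropCoord j ζ) : ξ = ζ := by
  rw [← insertCoord_dropCoord j ξ, h, h', insertCoord_dropCoord]

theorem mem_posOrthant_iff (j : ι) {ξ : ι → ℤ} :
    ξ ∈ posOrthant ι ↔ 1 ≤ ξ j ∧ dropCoord j ξ ∈ posOrthant {i // i ≠ j} := by
  constructor
  · exact fun h => ⟨h j, fun i => h i⟩
  · rintro ⟨h1, h2⟩ i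
    by_cases h : i = j
    · subst h
      exact h1
    · exact h2 ⟨i, h⟩

theorem insertCoord_mem {j : ι} {x : ℤ} (hx : 1 ≤ x) {z : {i // i ≠ j} → ℤ}
    (hz : z ∈ posOrthant {i // i ≠ j}) : insertCoord j x z ∈ posOrthant ι := by
  rw [mem_posOrthant_iff j]
  simpa using ⟨hx, hz⟩

/-- `dropCoord` on the positive orthant. -/
def dropPos (j : ι) (ξ : posOrthant ι) : posOrthant {i // i ≠ j} :=
  ⟨dropCoord j ξ, ((mem_posOrthant_iff j).1 ξ.2).2⟩

theorem sum_layer_le (j : ι) (x : ℤ) (u : lp (fun _ : posOrthant {i // i ≠ j} => ℂ) 2)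
    (s : Finset (posOrthant ι)) :
    ∑ ξ ∈ s, ‖if (ξ : ι → ℤ) j = x then u (dropPos j ξ) else 0‖ ^ (2 : ENNReal).toReal
      ≤ ‖u‖ ^ (2 : ENNReal).toReal := by
  classical
  have h2 : 0 < (2 : ENNReal).toReal := by norm_num
  have hinj : Set.InjOn (dropPos j) {ξ : posOrthant ι | (ξ : ι → ℤ) j = x} := by
    intro ξ hξ ζ hζ h
    exact Subtype.ext (eq_of_dropCoord_eq (Eq.trans hξ (Eq.symm hζ)) (congrArg Subtype.val h))
  have : ∑ ξ ∈ s, ‖if (ξ : ι → ℤ) j = x then u (dropPos j ξ) else 0‖ ^ (2 : ENNReal).toReal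
      = ∑ ζ ∈ (s.filter fun ξ : posOrthant ι => (ξ : ι → ℤ) j = x).image (dropPos j),
          ‖u ζ‖ ^ (2 : ENNReal).toReal := by
    rw [Finset.sum_image, Finset.sum_filter]
    rotate_left
    · intro ξ hξ ζ hζ h
      exact hinj (Finset.mem_filter.1 hξ).2 (Finset.mem_filter.1 hζ).2 h
    refine Finset.sum_congr rfl fun ξ _ => ?_
    split_ifs <;> simp
  rw [this]
  exact lp.sum_rpow_le_norm_rpow h2 u _

/-- The embedding of `ℓ²((ℕ*)^{ι ∖ {j}})` in `ℓ²((ℕ*)^ι)` as the sequences supported on the layer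
`{ξ | ξ j = x}`; it vanishes for `x ≤ 0`. -/
def layer (j : ι) (x : ℤ) :
    lp (fun _ : posOrthant {i // i ≠ j} => ℂ) 2 →L[ℂ] lp (fun _ : posOrthant ι => ℂ) 2 :=
  LinearMap.mkContinuous
    { toFun := fun u => ⟨fun ξ => if (ξ : ι → ℤ) j = x then u (dropPos j ξ) else 0,
        memℓp_gen' (sum_layer_le j x u)⟩
      map_add' := fun u w => by
        ext ξ
        change (if (ξ : ι → ℤ) j = x then u (dropPos j ξ) + w (dropPos j ξ) else 0)
          = (if (ξ : ι → ℤ) j = x then u (dropPos j ξ) else 0)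
            + (if (ξ : ι → ℤ) j = x then w (dropPos j ξ) else 0)
        split_ifs <;> simp
      map_smul' := fun c u => by
        ext ξ
        change (if (ξ : ι → ℤ) j = x then c • u (dropPos j ξ) else 0)
          = c • (if (ξ : ι → ℤ) j = x then u (dropPos j ξ) else 0)
        split_ifs <;> simp }
    1
    (fun u => by
      rw [one_mul]
      exact lp.norm_le_of_forall_sum_le (by norm_num) (norm_nonneg u) (sum_layer_le j x u))

theorem layer_apply (j : ι) (x : ℤ) (u : lp (fun _ : posOrthant {i // i ≠ j} => ℂ) 2)
    (ξ : posOrthant ι) :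
    layer j x u ξ = if (ξ : ι → ℤ) j = x then u (dropPos j ξ) else 0 :=
  rfl

theorem isLayering_layer (j : ι) : IsLayering (layer j) := by
  intro x y hx _ u w
  rw [lp.inner_eq_tsum]
  split_ifs with hxy
  · subst hxy
    let g : posOrthant {i // i ≠ j} → posOrthant ι := fun z =>
      ⟨insertCoord j x z, insertCoord_mem hx z.2⟩
    have hg : Function.Injective g := by
      intro z z' h
      have := congrArg (fun ξ : posOrthant ι => dropCoord j ξ) h
      simp only [g, dropCoord_insertCoord] at this
      exact Subtype.ext this
    have hdrop : ∀ z, dropPos j (g z) = z := fun z =>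
      Subtype.ext (dropCoord_insertCoord j x z)
    rw [lp.inner_eq_tsum, ← hg.tsum_eq]
    · refine tsum_congr fun z => ?_
      rw [layer_apply, layer_apply, if_pos (insertCoord_self j x z),
        if_pos (insertCoord_self j x z), hdrop]
    · intro ξ hξ
      by_cases h : (ξ : ι → ℤ) j = x
      · refine ⟨dropPos j ξ, Subtype.ext ?_⟩
        rw [← insertCoord_dropCoord j (ξ : ι → ℤ), h]
        rfl
      · refine absurd ?_ hξ
        simp only [layer_apply, if_neg h, inner_zero_left]
  · refine (tsum_congr fun ξ => ?_).trans tsum_zero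
    rw [layer_apply, layer_apply]
    by_cases h : (ξ : ι → ℤ) j = x
    · rw [if_neg (show ¬ (ξ : ι → ℤ) j = y from fun h' => hxy (h.symm.trans h')), inner_zero_right]
    · rw [if_neg h, inner_zero_left]

/-- A translation acts on layers by moving the layer and translating within it. No condition on
`x + η j` is needed, as both sides vanish when it is not positive. -/
theorem shift_layer (j : ι) {x : ℤ} (hx : 1 ≤ x) (η : ι → ℤ)
    (u : lp (fun _ : posOrthant {i // i ≠ j} => ℂ) 2) :
    shift (posOrthant ι) η (layer j x u)
      = layer j (x + η j) (shift (posOrthant {i // i ≠ j}) (dropCoord j η) u) := by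
  ext ξ
  rw [layer_apply]
  by_cases hj : (ξ : ι → ℤ) j = x + η j
  · rw [if_pos hj]
    have hj' : ((ξ : ι → ℤ) - η) j = x := by rw [Pi.sub_apply]; omega
    have hdrop : dropCoord j ((ξ : ι → ℤ) - η) = (dropPos j ξ : {i // i ≠ j} → ℤ) - dropCoord j η :=
      rfl
    have hiff := mem_posOrthant_iff j (ξ := (ξ : ι → ℤ) - η)
    rw [hj', hdrop] at hiff
    by_cases h : (ξ : ι → ℤ) - η ∈ posOrthant ι
    · rw [shift_apply_of_mem h, shift_apply_of_mem (hiff.1 h).2, layer_apply, if_pos hj']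
      rfl
    · rw [shift_apply_of_notMem h, shift_apply_of_notMem fun h' => h (hiff.2 ⟨hx, h'⟩)]
  · rw [if_neg hj]
    by_cases h : (ξ : ι → ℤ) - η ∈ posOrthant ι
    · rw [shift_apply_of_mem h, layer_apply, if_neg]
      change ¬ (ξ : ι → ℤ) j - η j = x
      omega
    · exact shift_apply_of_notMem h _

/-- On a layer `x > η j`, the projection `v_η v_η*` does not see the constraint on the `j`-th
coordinate. -/
theorem shiftProj_layer (j : ι) {x : ℤ} (hx : 1 ≤ x) {η : ι → ℤ} (hη : η j < x)
    (u : lp (fun _ : posOrthant {i // i ≠ j} => ℂ) 2) :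
    shiftProj (posOrthant ι) η (layer j x u)
      = layer j x (shiftProj (posOrthant {i // i ≠ j}) (dropCoord j η) u) := by
  rw [shiftProj, shiftProj, adjoint_shift, adjoint_shift, ContinuousLinearMap.comp_apply,
    shift_layer j hx, shift_layer j (by rw [Pi.neg_apply]; omega), Pi.neg_apply,
    neg_add_cancel_right]
  rfl

theorem single_eq_layer [DecidableEq (posOrthant ι)] (j : ι)
    [DecidableEq (posOrthant {i // i ≠ j})] (ξ : posOrthant ι) (a : ℂ) :
    lp.single 2 ξ a = layer j ((ξ : ι → ℤ) j) (lp.single 2 (dropPos j ξ) a) := by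
  ext ζ
  rw [layer_apply, lp.single_apply]
  by_cases h : ζ = ξ
  · subst h
    simp
  · rw [Pi.single_eq_of_ne h]
    split_ifs with hj
    · rw [lp.single_apply, Pi.single_eq_of_ne]
      exact fun h' => h (Subtype.ext (eq_of_dropCoord_eq hj (congrArg Subtype.val h')))
    · rfl

end Layer

/-! ### The Hamiltonian, its symbols at infinity, and truncation to finite range -/

section Hamiltonian

open ContinuousLinearMap

/-- The summand of index `η` of `T_ρ + V_ς`. -/
def hamTerm {X : Type*} [AddCommGroup X] (E : Set X) (ρ ς : X → ℂ) (η : X) :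
    lp (fun _ : E => ℂ) 2 →L[ℂ] lp (fun _ : E => ℂ) 2 :=
  ρ η • shift E η + ς η • shiftProj E η

theorem norm_hamTerm_le {X : Type*} [AddCommGroup X] (E : Set X) (ρ ς : X → ℂ) (η : X) :
    ‖hamTerm E ρ ς η‖ ≤ ‖ρ η‖ + ‖ς η‖ := by
  refine (norm_add_le _ _).trans ?_
  rw [norm_smul, norm_smul]
  exact add_le_add (mul_le_of_le_one_right (norm_nonneg _) (norm_shift_le η))
    (mul_le_of_le_one_right (norm_nonneg _) (norm_shiftProj_le η))

/-- The operator `T_ρ + V_ς`, as a single series. -/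
def hamiltonian {X : Type*} [AddCommGroup X] (E : Set X) (ρ ς : X → ℂ) :
    lp (fun _ : E => ℂ) 2 →L[ℂ] lp (fun _ : E => ℂ) 2 :=
  ∑' η : X, hamTerm E ρ ς η

variable {ι : Type*}

/-- The summand of index `η` of the symbol of `T_ρ + V_ς` in direction `j`: the translation by
`η j` becomes a phase, and the remaining coordinates act on `ℓ²((ℕ*)^{ι ∖ {j}})`. -/
def symbolTerm (j : ι) (τ : UnitAddCircle) (ρ ς : (ι → ℤ) → ℂ) (η : ι → ℤ) :
    lp (fun _ : posOrthant {i // i ≠ j} => ℂ) 2 →L[ℂ]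
      lp (fun _ : posOrthant {i // i ≠ j} => ℂ) 2 :=
  (fourier (-(η j)) τ * ρ η) • shift (posOrthant {i // i ≠ j}) (dropCoord j η)
    + ς η • shiftProj (posOrthant {i // i ≠ j}) (dropCoord j η)

theorem norm_symbolTerm_le (j : ι) (τ : UnitAddCircle) (ρ ς : (ι → ℤ) → ℂ) (η : ι → ℤ) :
    ‖symbolTerm j τ ρ ς η‖ ≤ ‖ρ η‖ + ‖ς η‖ := by
  refine (norm_add_le _ _).trans ?_
  rw [norm_smul, norm_smul, norm_mul, norm_fourier_apply, one_mul]
  exact add_le_add (mul_le_of_le_one_right (norm_nonneg _) (norm_shift_le _))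
    (mul_le_of_le_one_right (norm_nonneg _) (norm_shiftProj_le _))

/-- The symbol of `T_ρ + V_ς` in direction `j`: what remains of the operator far away from the
face `ξ j = 1`, at the frequency `τ` of the variable number `j`. -/
def symbol (j : ι) (τ : UnitAddCircle) (ρ ς : (ι → ℤ) → ℂ) :
    lp (fun _ : posOrthant {i // i ≠ j} => ℂ) 2 →L[ℂ]
      lp (fun _ : posOrthant {i // i ≠ j} => ℂ) 2 :=
  ∑' η : ι → ℤ, symbolTerm j τ ρ ς η

theorem norm_tsum_sub_sum_le {X Y : Type*} [NormedAddCommGroup Y] [CompleteSpace Y] {g : X → Y}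
    {w : X → ℝ} (hw : Summable w) (hg : ∀ η, ‖g η‖ ≤ w η) (F : Finset X) :
    ‖(∑' η, g η) - ∑ η ∈ F, g η‖ ≤ ∑' η : {η // η ∉ F}, w η := by
  have hgs : Summable g := .of_norm_bounded hw hg
  rw [← hgs.sum_add_tsum_subtype_compl F, add_sub_cancel_left]
  exact tsum_of_norm_bounded (hw.subtype _).hasSum fun η => hg η

theorem continuous_symbol (j : ι) {ρ ς : (ι → ℤ) → ℂ} (hρ : Summable fun η => ‖ρ η‖)
    (hς : Summable fun η => ‖ς η‖) : Continuous fun τ => symbol j τ ρ ς := by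
  refine continuous_tsum (u := fun η => ‖ρ η‖ + ‖ς η‖) (fun η => ?_) (hρ.add hς)
    fun η τ => norm_symbolTerm_le j τ ρ ς η
  unfold symbolTerm
  fun_prop

/-- By compactness of the torus, symbols that are bounded below for each frequency are so
uniformly. -/
theorem exists_uniform_lower_bound {T V W : Type*} [TopologicalSpace T] [CompactSpace T]
    [NormedAddCommGroup V] [NormedSpace ℂ V] [NormedAddCommGroup W] [NormedSpace ℂ W]
    {B : T → V →L[ℂ] W} (hB : Continuous B) (h : ∀ τ, IsBoundedBelow (B τ)) :
    ∃ c : ℝ, 0 < c ∧ ∀ τ f, c * ‖f‖ ≤ ‖B τ f‖ := by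
  have key : ∃ c : ℝ, 0 < c ∧ ∀ τ ∈ (Set.univ : Set T), ∀ f, c * ‖f‖ ≤ ‖B τ f‖ := by
    refine isCompact_univ.induction_on (p := fun s => ∃ c : ℝ, 0 < c ∧ ∀ τ ∈ s, ∀ f,
      c * ‖f‖ ≤ ‖B τ f‖) ⟨1, one_pos, by simp⟩ ?_ ?_ ?_
    · rintro s t hst ⟨c, hc, h⟩
      exact ⟨c, hc, fun τ hτ => h τ (hst hτ)⟩
    · rintro s t ⟨c, hc, h⟩ ⟨c', hc', h'⟩
      refine ⟨min c c', lt_min hc hc', fun τ hτ f => ?_⟩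
      rcases hτ with hτ | hτ
      · exact (mul_le_mul_of_nonneg_right (min_le_left _ _) (norm_nonneg f)).trans (h τ hτ f)
      · exact (mul_le_mul_of_nonneg_right (min_le_right _ _) (norm_nonneg f)).trans (h' τ hτ f)
    · intro τ _
      obtain ⟨c, hc, hτ⟩ := h τ
      refine ⟨{σ | dist (B σ) (B τ) < c / 2}, mem_nhdsWithin_of_mem_nhds ?_, c / 2, by positivity,
        fun σ hσ f => ?_⟩
      · exact hB.continuousAt.eventually (Metric.ball_mem_nhds _ (by positivity))
      · have h1 : ‖B σ - B τ‖ < c / 2 := by rw [← dist_eq_norm]; exact hσ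
        have h2 := (B σ - B τ).le_opNorm f
        have h3 := norm_sub_norm_le (B τ f) (B σ f)
        rw [norm_sub_rev] at h3
        rw [sub_apply] at h2
        nlinarith [hτ f, norm_nonneg f]
  obtain ⟨c, hc, h⟩ := key
  exact ⟨c, hc, fun τ => h τ (Set.mem_univ _)⟩

/-- The blocks of `∑ η ∈ F, hamTerm E ρ ς η` with respect to the layers in direction `j`. The
translations and the projections are listed separately: only the former change the layer. -/
def hamBlock (j : ι) (ρ ς : (ι → ℤ) → ℂ) : (ι → ℤ) ⊕ (ι → ℤ) →
    lp (fun _ : posOrthant {i // i ≠ j} => ℂ) 2 →L[ℂ]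
      lp (fun _ : posOrthant {i // i ≠ j} => ℂ) 2 :=
  Sum.elim (fun η => ρ η • shift (posOrthant {i // i ≠ j}) (dropCoord j η))
    (fun η => ς η • shiftProj (posOrthant {i // i ≠ j}) (dropCoord j η))

/-- The number of layers by which a block of `hamBlock` translates. -/
def hamDegree (j : ι) : (ι → ℤ) ⊕ (ι → ℤ) → ℤ := Sum.elim (fun η => η j) (fun _ => 0)

theorem blockSymbol_hamBlock (j : ι) (ρ ς : (ι → ℤ) → ℂ) (F : Finset (ι → ℤ))
    (τ : UnitAddCircle) :
    blockSymbol (F.disjSum F) (hamDegree j) (hamBlock j ρ ς) τ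
      = ∑ η ∈ F, symbolTerm j τ ρ ς η := by
  rw [blockSymbol, Finset.sum_disjSum, ← Finset.sum_add_distrib]
  refine Finset.sum_congr rfl fun η _ => ?_
  simp [symbolTerm, hamDegree, hamBlock, smul_smul]

theorem abs_hamDegree_le (j : ι) {F : Finset (ι → ℤ)} {R : ℤ} (hR : 0 ≤ R)
    (hF : ∀ η ∈ F, |η j| ≤ R) : ∀ k ∈ F.disjSum F, |hamDegree j k| ≤ R := by
  intro k hk
  rcases Finset.mem_disjSum.1 hk with ⟨η, hη, rfl⟩ | ⟨η, hη, rfl⟩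
  · exact hF η hη
  · simpa [hamDegree] using hR

variable [DecidableEq ι]

theorem sum_hamTerm_layer (j : ι) (ρ ς : (ι → ℤ) → ℂ) {F : Finset (ι → ℤ)} {R : ℤ} (hR : 0 ≤ R)
    (hF : ∀ η ∈ F, |η j| ≤ R) {x : ℤ} (hx : R < x)
    (u : lp (fun _ : posOrthant {i // i ≠ j} => ℂ) 2) :
    (∑ η ∈ F, hamTerm (posOrthant ι) ρ ς η) (layer j x u)
      = ∑ k ∈ F.disjSum F, layer j (x + hamDegree j k) (hamBlock j ρ ς k u) := by
  rw [Finset.sum_disjSum, ← Finset.sum_add_distrib, sum_apply]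
  refine Finset.sum_congr rfl fun η hη => ?_
  have h := abs_le.1 (hF η hη)
  simp only [hamTerm, add_apply, smul_apply, hamDegree, hamBlock, Sum.elim_inl, Sum.elim_inr,
    map_smul, add_zero]
  have hx1 : 1 ≤ x := by linarith [hR]
  rw [shift_layer j hx1, shiftProj_layer j hx1 (by omega)]

/-- For an operator of finite range, a lower bound of the symbol in direction `j` holds for the
operator on all sequences supported at distance more than `R` from the face `ξ j = 1`, by density of
the finitely supported ones. -/
theorem lower_bound_of_symbolTerm {j : ι} {ρ ς : (ι → ℤ) → ℂ} {F : Finset (ι → ℤ)} {R : ℤ}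
    (hR : 0 ≤ R) (hF : ∀ η ∈ F, |η j| ≤ R) {c : ℝ} (hc : 0 ≤ c)
    (hsym : ∀ τ u, c * ‖u‖ ≤ ‖(∑ η ∈ F, symbolTerm j τ ρ ς η) u‖)
    {f : lp (fun _ : posOrthant ι => ℂ) 2}
    (hf : ∀ ξ : posOrthant ι, (ξ : ι → ℤ) j ≤ R → f ξ = 0) :
    c * ‖f‖ ≤ ‖(∑ η ∈ F, hamTerm (posOrthant ι) ρ ς η) f‖ := by
  classical
  set A := ∑ η ∈ F, hamTerm (posOrthant ι) ρ ς η
  have hfin : ∀ s : Finset (posOrthant ι), c * ‖∑ ξ ∈ s, lp.single 2 ξ (f ξ)‖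
      ≤ ‖A (∑ ξ ∈ s, lp.single 2 ξ (f ξ))‖ := by
    intro s
    have hs : ∑ ξ ∈ s, lp.single (E := fun _ : posOrthant ι => ℂ) 2 ξ (f ξ)
        = ∑ ξ ∈ s.filter (fun ξ : posOrthant ι => R < (ξ : ι → ℤ) j),
            layer j ((ξ : ι → ℤ) j) (lp.single 2 (dropPos j ξ) (f ξ)) := by
      rw [Finset.sum_filter]
      refine Finset.sum_congr rfl fun ξ _ => ?_
      split_ifs with h
      · exact single_eq_layer j ξ (f ξ)
      · rw [hf ξ (not_lt.1 h), lp.single_zero]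
    rw [hs]
    refine (isLayering_layer j).lower_bound_of_blockSymbol hR (abs_hamDegree_le j hR hF)
      (fun x hx u => sum_hamTerm_layer j ρ ς hR hF hx u) hc ?_ _ _ ?_ _
    · intro τ u
      rw [blockSymbol_hamBlock]
      exact hsym τ u
    · exact fun ξ hξ => (Finset.mem_filter.1 hξ).2
  have hlim : Filter.Tendsto (fun s : Finset (posOrthant ι) => ∑ ξ ∈ s, lp.single 2 ξ (f ξ))
      Filter.atTop (nhds f) := lp.hasSum_single (by norm_num) f
  exact le_of_tendsto_of_tendsto (hlim.norm.const_mul c)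
    ((A.continuous.tendsto f).comp hlim).norm (Filter.Eventually.of_forall hfin)

/-- For an operator of finite range, a lower bound at infinity is inherited, with the same constant,
by the symbols in all directions. -/
theorem lower_bound_symbolTerm {j : ι} {ρ ς : (ι → ℤ) → ℂ} {F : Finset (ι → ℤ)} {c : ℝ}
    {S : Finset (posOrthant ι)}
    (h : ∀ f : lp (fun _ : posOrthant ι => ℂ) 2, (∀ ξ ∈ S, f ξ = 0) →
      c * ‖f‖ ≤ ‖(∑ η ∈ F, hamTerm (posOrthant ι) ρ ς η) f‖)
    (τ : UnitAddCircle) (u : lp (fun _ : posOrthant {i // i ≠ j} => ℂ) 2) :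
    c * ‖u‖ ≤ ‖(∑ η ∈ F, symbolTerm j τ ρ ς η) u‖ := by
  set R : ℤ := ∑ η ∈ F, |η j|
  have hR : 0 ≤ R := Finset.sum_nonneg fun _ _ => abs_nonneg _
  have hF : ∀ η ∈ F, |η j| ≤ R := fun η hη =>
    Finset.single_le_sum (f := fun η : ι → ℤ => |η j|) (fun _ _ => abs_nonneg _) hη
  set m : ℤ := R + 1 + ∑ ξ ∈ S, |(ξ : ι → ℤ) j|
  have hS : ∀ ξ ∈ S, (ξ : ι → ℤ) j < m := by
    intro ξ hξ
    have h1 := Finset.single_le_sum (f := fun ξ : posOrthant ι => |(ξ : ι → ℤ) j|)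
      (fun _ _ => abs_nonneg _) hξ
    have h2 := le_abs_self ((ξ : ι → ℤ) j)
    omega
  have hm : R < m := by
    have : 0 ≤ ∑ ξ ∈ S, |(ξ : ι → ℤ) j| := Finset.sum_nonneg fun _ _ => abs_nonneg _
    omega
  rw [← blockSymbol_hamBlock]
  refine (isLayering_layer j).lower_bound_blockSymbol hR (abs_hamDegree_le j hR hF)
      (fun x hx u => sum_hamTerm_layer j ρ ς hR hF hx u) hm (fun τ L u => h _ fun ξ hξ => ?_) τ u
  rw [planeWave, lp.coeFn_sum, Finset.sum_apply]
  refine Finset.sum_eq_zero fun i _ => ?_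
  have := hS ξ hξ
  rw [lp.coeFn_smul, Pi.smul_apply, layer_apply, if_neg (by omega), smul_zero]

end Hamiltonian

/-! ### Localization to the regions where one coordinate is large -/

section Localization

open ContinuousLinearMap

variable {ι : Type*}

/-- The distance of `ξ i` to `(-∞, R]`. -/
def excess (R : ℤ) (ξ : ι → ℤ) (i : ι) : ℝ := max ((ξ i : ℝ) - R) 0

theorem excess_nonneg (R : ℤ) (ξ : ι → ℤ) (i : ι) : 0 ≤ excess R ξ i := le_max_right _ _

theorem excess_eq_zero {R : ℤ} {ξ : ι → ℤ} {i : ι} (h : ξ i ≤ R) : excess R ξ i = 0 := by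
  refine max_eq_right ?_
  have : (ξ i : ℝ) ≤ R := by exact_mod_cast h
  linarith

theorem abs_excess_add_sub_le (R : ℤ) (ξ η : ι → ℤ) (i : ι) :
    |excess R (ξ + η) i - excess R ξ i| ≤ |(η i : ℝ)| := by
  refine (abs_max_sub_max_le_abs _ _ _).trans ?_
  rw [Pi.add_apply]
  push_cast
  rw [show (ξ i : ℝ) + η i - R - (ξ i - R) = η i by ring]

variable [Fintype ι]

/-- The sum of all excesses of the coordinates over `R`. -/
def totalExcess (R : ℤ) (ξ : ι → ℤ) : ℝ := ∑ i, excess R ξ i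

theorem totalExcess_nonneg (R : ℤ) (ξ : ι → ℤ) : 0 ≤ totalExcess R ξ :=
  Finset.sum_nonneg fun i _ => excess_nonneg R ξ i

theorem excess_le_totalExcess (R : ℤ) (ξ : ι → ℤ) (i : ι) : excess R ξ i ≤ totalExcess R ξ :=
  Finset.single_le_sum (f := excess R ξ) (fun i _ => excess_nonneg R ξ i) (Finset.mem_univ i)

theorem abs_totalExcess_add_sub_le (R : ℤ) (ξ η : ι → ℤ) :
    |totalExcess R (ξ + η) - totalExcess R ξ| ≤ ∑ i, |(η i : ℝ)| := by
  rw [totalExcess, totalExcess, ← Finset.sum_sub_distrib]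
  exact (Finset.abs_sum_le_sum_abs _ _).trans
    (Finset.sum_le_sum fun i _ => abs_excess_add_sub_le R ξ η i)

theorem finite_totalExcess_le (R : ℤ) (M : ℕ) :
    {ξ : posOrthant ι | totalExcess R (ξ : ι → ℤ) ≤ M}.Finite := by
  classical
  refine ((Set.finite_Icc (1 : ι → ℤ) (fun _ => R + M)).preimage
    (f := fun ξ : posOrthant ι => (ξ : ι → ℤ)) Subtype.val_injective.injOn).subset fun ξ hξ => ?_
  refine ⟨fun i => ξ.2 i, fun i => ?_⟩
  have h1 := (excess_le_totalExcess R (ξ : ι → ℤ) i).trans hξ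
  have h2 := (le_max_left _ _).trans h1
  have h3 : ((ξ : ι → ℤ) i : ℝ) ≤ R + M := by linarith
  exact_mod_cast h3

/-- The `j`-th member of a partition of unity, supported where `R < ξ j`. It is homogeneous of
degree zero up to the cutoff at `R`, hence slowly varying at infinity. -/
def cutoff (R : ℤ) (j : ι) (ξ : ι → ℤ) : ℝ := excess R ξ j / totalExcess R ξ

theorem abs_cutoff_le (R : ℤ) (j : ι) (ξ : ι → ℤ) : |cutoff R j ξ| ≤ 1 := by
  rw [cutoff, abs_of_nonneg (div_nonneg (excess_nonneg R ξ j) (totalExcess_nonneg R ξ))]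
  exact div_le_one_of_le₀ (excess_le_totalExcess R ξ j) (totalExcess_nonneg R ξ)

theorem sum_cutoff {R : ℤ} {ξ : ι → ℤ} (h : 0 < totalExcess R ξ) : ∑ j, cutoff R j ξ = 1 := by
  simp only [cutoff]
  rw [← Finset.sum_div]
  exact div_self h.ne'

theorem abs_cutoff_sub_cutoff_add_le {R : ℤ} (j : ι) {ξ η : ι → ℤ} {r : ℝ}
    (hη : ∑ i, |(η i : ℝ)| ≤ r) {M : ℝ} (hM : 0 < M) (h : M < totalExcess R ξ) :
    |cutoff R j ξ - cutoff R j (ξ + η)| ≤ 2 * r / M := by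
  set p := excess R ξ j
  set q := excess R (ξ + η) j
  set s := totalExcess R ξ
  set t := totalExcess R (ξ + η)
  have hs : 0 < s := hM.trans h
  have hpq : |p - q| ≤ r := by
    rw [abs_sub_comm]
    exact (abs_excess_add_sub_le R ξ η j).trans ((Finset.single_le_sum
      (f := fun i => |(η i : ℝ)|) (fun i _ => abs_nonneg _) (Finset.mem_univ j)).trans hη)
  have hst : |t - s| ≤ r := (abs_totalExcess_add_sub_le R ξ η).trans hη
  have hr : 0 ≤ r := (abs_nonneg _).trans hpq
  have hqt : |q / t| ≤ 1 := abs_cutoff_le R j (ξ + η)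
  -- If `t = 0` then also `q = 0`, so that the identity holds with the convention `q / 0 = 0`.
  have heq : p / s - q / t = (p - q + q / t * (t - s)) / s := by
    by_cases ht : t = 0
    · have hq : q = 0 := le_antisymm ((excess_le_totalExcess R (ξ + η) j).trans ht.le)
        (excess_nonneg R _ j)
      rw [ht, hq]
      simp
    · field_simp
      ring
  change |p / s - q / t| ≤ _
  rw [heq, abs_div, abs_of_pos hs]
  have hnum : |p - q + q / t * (t - s)| ≤ 2 * r := by
    refine (abs_add_le _ _).trans ?_
    rw [abs_mul]
    have := mul_le_mul hqt hst (abs_nonneg _) zero_le_one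
    linarith
  exact div_le_div₀ (by positivity) hnum hM h.le

/-- Multiplication by `cutoff R j` in `ℓ²((ℕ*)^ι)`. -/
def cutoffOp (R : ℤ) (j : ι) :
    lp (fun _ : posOrthant ι => ℂ) 2 →L[ℂ] lp (fun _ : posOrthant ι => ℂ) 2 :=
  mulOp (fun ξ : posOrthant ι => cutoff R j ξ) fun ξ => abs_cutoff_le R j ξ

theorem sum_cutoffOp_apply {R : ℤ} {f : lp (fun _ : posOrthant ι => ℂ) 2}
    (hf : ∀ ξ : posOrthant ι, totalExcess R (ξ : ι → ℤ) ≤ 0 → f ξ = 0) :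
    ∑ j, cutoffOp R j f = f := by
  ext ξ
  rw [lp.coeFn_sum, Finset.sum_apply]
  simp only [cutoffOp, mulOp_apply]
  rw [← Finset.sum_mul, ← Complex.ofReal_sum]
  by_cases h : totalExcess R (ξ : ι → ℤ) ≤ 0
  · rw [hf ξ h, mul_zero]
  · rw [sum_cutoff (not_le.1 h), Complex.ofReal_one, one_mul]

theorem norm_shift_cutoffOp_sub_le {R : ℤ} (j : ι) {η : ι → ℤ} {r : ℝ}
    (hη : ∑ i, |(η i : ℝ)| ≤ r) {M : ℝ} (hM : 0 < M) {f : lp (fun _ : posOrthant ι => ℂ) 2}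
    (hf : ∀ ξ : posOrthant ι, totalExcess R (ξ : ι → ℤ) ≤ M → f ξ = 0) :
    ‖shift (posOrthant ι) η (cutoffOp R j f) - cutoffOp R j (shift (posOrthant ι) η f)‖
      ≤ 2 * r / M * ‖f‖ := by
  have hr : 0 ≤ r := (Finset.sum_nonneg fun i _ => abs_nonneg _).trans hη
  have h1 : ‖shift (posOrthant ι) η (cutoffOp R j f) - cutoffOp R j (shift (posOrthant ι) η f)‖
      ≤ ‖((2 * r / M : ℝ) : ℂ) • shift (posOrthant ι) η f‖ := by
    refine lp.norm_mono (by norm_num) fun ξ => ?_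
    rw [lp.coeFn_sub, lp.coeFn_smul, Pi.sub_apply, Pi.smul_apply, smul_eq_mul, norm_mul,
      Complex.norm_real, Real.norm_of_nonneg (by positivity)]
    by_cases h : (ξ : ι → ℤ) - η ∈ posOrthant ι
    · rw [shift_apply_of_mem h]
      simp only [cutoffOp, mulOp_apply]
      rw [shift_apply_of_mem h, ← sub_mul, norm_mul, ← Complex.ofReal_sub, Complex.norm_real,
        Real.norm_eq_abs]
      by_cases hM' : totalExcess R ((ξ : ι → ℤ) - η) ≤ M
      · rw [hf ⟨_, h⟩ hM', norm_zero, mul_zero, mul_zero]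
      · refine mul_le_mul_of_nonneg_right ?_ (norm_nonneg _)
        have := abs_cutoff_sub_cutoff_add_le j hη hM (not_le.1 hM')
        rwa [sub_add_cancel] at this
    · rw [shift_apply_of_notMem h]
      simp only [cutoffOp, mulOp_apply]
      rw [shift_apply_of_notMem h]
      simp
  refine h1.trans ?_
  rw [norm_smul, Complex.norm_real, Real.norm_of_nonneg (by positivity)]
  refine mul_le_mul_of_nonneg_left ?_ (by positivity)
  exact (le_opNorm _ f).trans (mul_le_of_le_one_left (norm_nonneg _) (norm_shift_le η))

theorem shiftProj_cutoffOp (R : ℤ) (j : ι) (η : ι → ℤ) (f : lp (fun _ : posOrthant ι => ℂ) 2) :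
    shiftProj (posOrthant ι) η (cutoffOp R j f) = cutoffOp R j (shiftProj (posOrthant ι) η f) := by
  classical
  ext ξ
  simp only [cutoffOp, mulOp_apply, shiftProj_apply, mul_ite, mul_zero]

/-- The commutator of an operator of finite range with a cutoff is small at infinity. -/
theorem norm_sum_hamTerm_cutoffOp_sub_le {R : ℤ} (j : ι) (ρ ς : (ι → ℤ) → ℂ)
    {F : Finset (ι → ℤ)} {r : ℝ} (hF : ∀ η ∈ F, ∑ i, |(η i : ℝ)| ≤ r) {M : ℝ} (hM : 0 < M)
    {f : lp (fun _ : posOrthant ι => ℂ) 2}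
    (hf : ∀ ξ : posOrthant ι, totalExcess R (ξ : ι → ℤ) ≤ M → f ξ = 0) :
    ‖(∑ η ∈ F, hamTerm (posOrthant ι) ρ ς η) (cutoffOp R j f)
        - cutoffOp R j ((∑ η ∈ F, hamTerm (posOrthant ι) ρ ς η) f)‖
      ≤ (∑ η ∈ F, ‖ρ η‖) * (2 * r / M) * ‖f‖ := by
  rw [sum_apply, sum_apply, map_sum, ← Finset.sum_sub_distrib, mul_assoc, Finset.sum_mul]
  refine norm_sum_le_of_le _ fun η hη => ?_
  have : hamTerm (posOrthant ι) ρ ς η (cutoffOp R j f)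
      - cutoffOp R j (hamTerm (posOrthant ι) ρ ς η f)
      = ρ η • (shift (posOrthant ι) η (cutoffOp R j f)
          - cutoffOp R j (shift (posOrthant ι) η f)) := by
    simp only [hamTerm, add_apply, smul_apply, map_add, map_smul, shiftProj_cutoffOp, smul_sub]
    abel
  rw [this, norm_smul]
  exact mul_le_mul_of_nonneg_left (norm_shift_cutoffOp_sub_le j (hF η hη) hM hf) (norm_nonneg _)

variable [DecidableEq ι]

/-- Lower bounds `c j` of the symbols in all directions `j` imply a lower bound at infinity of an
operator of finite range, with a constant close to `(∑ j, (c j)⁻¹)⁻¹`. -/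
theorem norm_le_of_lower_bound_symbolTerm (ρ ς : (ι → ℤ) → ℂ) (F : Finset (ι → ℤ)) {c : ι → ℝ}
    (hc : ∀ j, 0 < c j)
    (hsym : ∀ j τ u, c j * ‖u‖ ≤ ‖(∑ η ∈ F, symbolTerm j τ ρ ς η) u‖) {δ : ℝ} (hδ : 0 < δ) :
    ∃ S : Finset (posOrthant ι), ∀ f : lp (fun _ : posOrthant ι => ℂ) 2, (∀ ξ ∈ S, f ξ = 0) →
      ‖f‖ ≤ (∑ j, (c j)⁻¹) * (‖(∑ η ∈ F, hamTerm (posOrthant ι) ρ ς η) f‖ + δ * ‖f‖) := by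
  classical
  set A := ∑ η ∈ F, hamTerm (posOrthant ι) ρ ς η
  set R : ℤ := ∑ η ∈ F, ∑ i, |η i| with hRdef
  have hR : 0 ≤ R := Finset.sum_nonneg fun _ _ => Finset.sum_nonneg fun _ _ => abs_nonneg _
  have hFsum : ∀ η ∈ F, ∑ i, |η i| ≤ R := fun η hη =>
    Finset.single_le_sum (f := fun η : ι → ℤ => ∑ i, |η i|)
      (fun _ _ => Finset.sum_nonneg fun _ _ => abs_nonneg _) hη
  have hF : ∀ j, ∀ η ∈ F, |η j| ≤ R := fun j η hη =>
    (Finset.single_le_sum (f := fun i => |η i|) (fun _ _ => abs_nonneg _)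
      (Finset.mem_univ j)).trans (hFsum η hη)
  have hF' : ∀ η ∈ F, ∑ i, |(η i : ℝ)| ≤ R := fun η hη => by exact_mod_cast hFsum η hη
  set N : ℝ := ∑ η ∈ F, ‖ρ η‖
  have hN : 0 ≤ N := Finset.sum_nonneg fun _ _ => norm_nonneg _
  have hR' : (0 : ℝ) ≤ R := by exact_mod_cast hR
  obtain ⟨M, hM⟩ := exists_nat_gt (N * (2 * R) / δ)
  have hM0 : (0 : ℝ) < M := lt_of_le_of_lt (by positivity) hM
  have hδM : N * (2 * R / M) ≤ δ := by
    rw [div_lt_iff₀ hδ] at hM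
    rw [← mul_div_assoc, div_le_iff₀ hM0]
    linarith
  refine ⟨(finite_totalExcess_le (ι := ι) R M).toFinset, fun f hf => ?_⟩
  have hf' : ∀ ξ : posOrthant ι, totalExcess R (ξ : ι → ℤ) ≤ M → f ξ = 0 := fun ξ hξ =>
    hf ξ ((Set.Finite.mem_toFinset _).2 hξ)
  have hsum : ∑ j, cutoffOp R j f = f := sum_cutoffOp_apply fun ξ hξ => hf' ξ (hξ.trans hM0.le)
  have hj : ∀ j, ‖cutoffOp R j f‖ ≤ (c j)⁻¹ * (‖A f‖ + δ * ‖f‖) := by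
    intro j
    have h1 : c j * ‖cutoffOp R j f‖ ≤ ‖A (cutoffOp R j f)‖ := by
      refine lower_bound_of_symbolTerm hR (hF j) (hc j).le (hsym j) fun ξ hξ => ?_
      rw [cutoffOp, mulOp_apply, cutoff, excess_eq_zero hξ, zero_div, Complex.ofReal_zero, zero_mul]
    have h2 := norm_sum_hamTerm_cutoffOp_sub_le j ρ ς hF' hM0 hf'
    have h3 := norm_le_norm_add_norm_sub' (A (cutoffOp R j f)) (cutoffOp R j (A f))
    have h4 : ‖cutoffOp R j (A f)‖ ≤ ‖A f‖ := (le_opNorm _ _).trans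
      (mul_le_of_le_one_left (norm_nonneg _) (norm_mulOp_le _ _))
    have h5 := mul_le_mul_of_nonneg_right hδM (norm_nonneg f)
    rw [inv_mul_eq_div, le_div_iff₀ (hc j), mul_comm]
    linarith
  calc ‖f‖ = ‖∑ j, cutoffOp R j f‖ := by rw [hsum]
    _ ≤ ∑ j, (c j)⁻¹ * (‖A f‖ + δ * ‖f‖) := norm_sum_le_of_le _ fun j _ => hj j
    _ = _ := by rw [Finset.sum_mul]

/-- The operator `T_ρ + V_ς` is bounded below at infinity if and only if all its symbols are
bounded below. -/
theorem isBoundedBelowAtInfinity_hamiltonian_iff {ρ ς : (ι → ℤ) → ℂ}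
    (hρ : Summable fun η => ‖ρ η‖) (hς : Summable fun η => ‖ς η‖) :
    IsBoundedBelowAtInfinity (hamiltonian (posOrthant ι) ρ ς)
      ↔ ∀ j τ, IsBoundedBelow (symbol j τ ρ ς) := by
  classical
  -- A common truncation to finite range of the operator and of all its symbols.
  have htrunc : ∀ ε : ℝ, 0 < ε → ∃ F : Finset (ι → ℤ),
      (∀ f, ‖hamiltonian (posOrthant ι) ρ ς f
        - (∑ η ∈ F, hamTerm (posOrthant ι) ρ ς η) f‖ ≤ ε * ‖f‖) ∧
      ∀ j τ u, ‖symbol j τ ρ ς u - (∑ η ∈ F, symbolTerm j τ ρ ς η) u‖ ≤ ε * ‖u‖ := by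
    intro ε hε
    have hw := hρ.add hς
    obtain ⟨F, hF⟩ := ((tendsto_tsum_compl_atTop_zero fun η => ‖ρ η‖ + ‖ς η‖).eventually
      (gt_mem_nhds hε)).exists
    refine ⟨F, fun f => ?_, fun j τ u => ?_⟩
    · rw [← sub_apply]
      refine (le_opNorm _ _).trans (mul_le_mul_of_nonneg_right ?_ (norm_nonneg _))
      exact (norm_tsum_sub_sum_le hw (norm_hamTerm_le _ ρ ς) F).trans hF.le
    · rw [← sub_apply]
      refine (le_opNorm _ _).trans (mul_le_mul_of_nonneg_right ?_ (norm_nonneg _))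
      exact (norm_tsum_sub_sum_le hw (norm_symbolTerm_le j τ ρ ς) F).trans hF.le
  constructor
  · rintro ⟨c, hc, S, hS⟩ j τ
    obtain ⟨F, hF, hFsym⟩ := htrunc (c / 4) (by positivity)
    refine ⟨c / 2, by positivity, fun u => ?_⟩
    have h1 : ∀ f : lp (fun _ : posOrthant ι => ℂ) 2, (∀ ξ ∈ S, f ξ = 0) →
        (3 * c / 4) * ‖f‖ ≤ ‖(∑ η ∈ F, hamTerm (posOrthant ι) ρ ς η) f‖ := by
      intro f hf
      have h2 := hS f hf
      have h3 := norm_le_norm_add_norm_sub' (hamiltonian (posOrthant ι) ρ ς f)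
        ((∑ η ∈ F, hamTerm (posOrthant ι) ρ ς η) f)
      linarith [hF f]
    have h4 := lower_bound_symbolTerm h1 τ u
    have h5 := norm_le_norm_add_norm_sub (symbol j τ ρ ς u) ((∑ η ∈ F, symbolTerm j τ ρ ς η) u)
    linarith [hFsym j τ u]
  · intro h
    choose c hc hlow using fun j => exists_uniform_lower_bound (continuous_symbol j hρ hς) (h j)
    set C : ℝ := ∑ j, (c j)⁻¹
    have hC : 0 ≤ C := Finset.sum_nonneg fun j _ => (inv_pos.2 (hc j)).le
    set ε : ℝ := (8 * (C + 1))⁻¹ with hε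
    have hε0 : 0 < ε := by positivity
    have hεC : ε * C ≤ 1 / 8 := by
      rw [hε, inv_mul_le_iff₀ (by positivity)]
      linarith
    have hεc : ∀ j, ε ≤ c j / 2 := by
      intro j
      have h1 : (c j)⁻¹ ≤ C := Finset.single_le_sum (f := fun j => (c j)⁻¹)
        (fun j _ => (inv_pos.2 (hc j)).le) (Finset.mem_univ j)
      have h2 : ε * (c j)⁻¹ ≤ 1 / 8 := (mul_le_mul_of_nonneg_left h1 hε0.le).trans hεC
      rw [← div_eq_mul_inv, div_le_iff₀ (hc j)] at h2
      linarith [hc j]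
    obtain ⟨F, hF, hFsym⟩ := htrunc ε hε0
    obtain ⟨S, hS⟩ := norm_le_of_lower_bound_symbolTerm ρ ς F (c := fun j => c j / 2)
      (fun j => half_pos (hc j)) (fun j τ u => by
        have h1 := norm_le_norm_add_norm_sub' (symbol j τ ρ ς u)
          ((∑ η ∈ F, symbolTerm j τ ρ ς η) u)
        have h2 := mul_le_mul_of_nonneg_right (hεc j) (norm_nonneg u)
        linarith [hlow j τ u, hFsym j τ u]) hε0
    refine ⟨2 * ε, by positivity, S, fun f hf => ?_⟩
    have h1 := hS f hf
    have h2 : ∑ j, (c j / 2)⁻¹ = 2 * C := by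
      rw [Finset.mul_sum]
      exact Finset.sum_congr rfl fun j _ => by rw [inv_div, div_eq_mul_inv]
    rw [h2] at h1
    have h3 := norm_le_norm_add_norm_sub (hamiltonian (posOrthant ι) ρ ς f)
      ((∑ η ∈ F, hamTerm (posOrthant ι) ρ ς η) f)
    have h4 := hF f
    -- `‖f‖ ≤ 2 C (‖H f‖ + 2 ε ‖f‖)` with `ε C ≤ 1 / 8`.
    have h5 : ‖f‖ ≤ 2 * C * (‖hamiltonian (posOrthant ι) ρ ς f‖ + 2 * ε * ‖f‖) :=
      h1.trans (mul_le_mul_of_nonneg_left (by linarith) (by positivity))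
    have h6 : ε * ‖f‖ ≤ 2 * (ε * C) * (‖hamiltonian (posOrthant ι) ρ ς f‖ + 2 * ε * ‖f‖) := by
      refine (mul_le_mul_of_nonneg_left h5 hε0.le).trans_eq ?_
      ring
    have h7 : 0 ≤ ‖hamiltonian (posOrthant ι) ρ ς f‖ + 2 * ε * ‖f‖ := by positivity
    have h8 := mul_le_mul_of_nonneg_right hεC h7
    linarith [norm_nonneg (hamiltonian (posOrthant ι) ρ ς f)]

end Localization

/-! ### Adjoints, spectral shifts and the Fredholm criterion -/

section Fredholm

open ContinuousLinearMap

theorem summable_hamTerm {X : Type*} [AddCommGroup X] (E : Set X) {ρ ς : X → ℂ}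
    (hρ : Summable fun η => ‖ρ η‖) (hς : Summable fun η => ‖ς η‖) : Summable (hamTerm E ρ ς) :=
  .of_norm_bounded (hρ.add hς) (norm_hamTerm_le E ρ ς)

theorem hamiltonian_eq_toeplitz_add_potential {X : Type*} [AddCommGroup X] (E : Set X)
    {ρ ς : X → ℂ} (hρ : Summable fun η => ‖ρ η‖) (hς : Summable fun η => ‖ς η‖) :
    hamiltonian E ρ ς = toeplitz E ρ + potential E ς := by
  refine Summable.tsum_add ?_ ?_
  · refine .of_norm_bounded hρ fun η => ?_
    rw [norm_smul]
    exact mul_le_of_le_one_right (norm_nonneg _) (norm_shift_le η)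
  · refine .of_norm_bounded hς fun η => ?_
    rw [norm_smul]
    exact mul_le_of_le_one_right (norm_nonneg _) (norm_shiftProj_le η)

/-- The function `ρ*` with `T_ρ* = T_{ρ*}`. -/
def conjNeg {X : Type*} [Neg X] (ρ : X → ℂ) (η : X) : ℂ := starRingEnd ℂ (ρ (-η))

theorem summable_norm_conjNeg {X : Type*} [AddCommGroup X] {ρ : X → ℂ}
    (hρ : Summable fun η => ‖ρ η‖) : Summable fun η => ‖conjNeg ρ η‖ := by
  simp only [conjNeg, RCLike.norm_conj]
  exact hρ.comp_injective neg_injective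

theorem adjoint_tsum {X V : Type*} [NormedAddCommGroup V] [InnerProductSpace ℂ V]
    [CompleteSpace V] (k : X → V →L[ℂ] V) : adjoint (∑' η, k η) = ∑' η, adjoint (k η) := by
  simp only [← star_eq_adjoint]
  exact tsum_star

theorem adjoint_tsum_add {X V : Type*} [AddCommGroup X] [NormedAddCommGroup V]
    [InnerProductSpace ℂ V] [CompleteSpace V] {g h g' h' : X → V →L[ℂ] V} (hg : Summable g)
    (hh : Summable h) (hg' : Summable g') (hh' : Summable h')
    (hgg' : ∀ η, adjoint (g η) = g' (-η)) (hhh' : ∀ η, adjoint (h η) = h' η) :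
    adjoint (∑' η, (g η + h η)) = ∑' η, (g' η + h' η) := by
  rw [Summable.tsum_add hg hh, map_add, adjoint_tsum, adjoint_tsum, tsum_congr hgg',
    tsum_congr hhh', Summable.tsum_add hg' hh', ← (Equiv.neg X).tsum_eq g']
  simp only [Equiv.neg_apply]

theorem adjoint_hamiltonian {X : Type*} [AddCommGroup X] (E : Set X) {ρ ς : X → ℂ}
    (hρ : Summable fun η => ‖ρ η‖) (hς : Summable fun η => ‖ς η‖) :
    adjoint (hamiltonian E ρ ς) = hamiltonian E (conjNeg ρ) fun η => starRingEnd ℂ (ς η) := by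
  have h1 : ∀ {ρ : X → ℂ}, (Summable fun η => ‖ρ η‖) → Summable fun η => ρ η • shift E η := by
    intro ρ hρ
    refine .of_norm_bounded hρ fun η => ?_
    rw [norm_smul]
    exact mul_le_of_le_one_right (norm_nonneg _) (norm_shift_le η)
  have h2 : ∀ {ς : X → ℂ}, (Summable fun η => ‖ς η‖) → Summable fun η => ς η • shiftProj E η := by
    intro ς hς
    refine .of_norm_bounded hς fun η => ?_
    rw [norm_smul]
    exact mul_le_of_le_one_right (norm_nonneg _) (norm_shiftProj_le η)
  refine adjoint_tsum_add (h1 hρ) (h2 hς) (h1 (summable_norm_conjNeg hρ))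
    (h2 (by simpa only [RCLike.norm_conj] using hς)) (fun η => ?_) (fun η => ?_)
  · rw [map_smulₛₗ, adjoint_shift, conjNeg, neg_neg]
  · rw [map_smulₛₗ, adjoint_shiftProj]

theorem adjoint_symbol {ι : Type*} (j : ι) (τ : UnitAddCircle) {ρ ς : (ι → ℤ) → ℂ}
    (hρ : Summable fun η => ‖ρ η‖) (hς : Summable fun η => ‖ς η‖) :
    adjoint (symbol j τ ρ ς) = symbol j τ (conjNeg ρ) fun η => starRingEnd ℂ (ς η) := by
  have h1 : ∀ {ρ : (ι → ℤ) → ℂ}, (Summable fun η => ‖ρ η‖) → Summable fun η =>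
      (fourier (-(η j)) τ * ρ η) • shift (posOrthant {i // i ≠ j}) (dropCoord j η) := by
    intro ρ hρ
    refine .of_norm_bounded hρ fun η => ?_
    rw [norm_smul, norm_mul, norm_fourier_apply, one_mul]
    exact mul_le_of_le_one_right (norm_nonneg _) (norm_shift_le _)
  have h2 : ∀ {ς : (ι → ℤ) → ℂ}, (Summable fun η => ‖ς η‖) → Summable fun η =>
      ς η • shiftProj (posOrthant {i // i ≠ j}) (dropCoord j η) := by
    intro ς hς
    refine .of_norm_bounded hς fun η => ?_
    rw [norm_smul]
    exact mul_le_of_le_one_right (norm_nonneg _) (norm_shiftProj_le _)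
  refine adjoint_tsum_add (h1 hρ) (h2 hς) (h1 (summable_norm_conjNeg hρ))
    (h2 (by simpa only [RCLike.norm_conj] using hς)) (fun η => ?_) (fun η => ?_)
  · rw [map_smulₛₗ, adjoint_shift, conjNeg, neg_neg, Pi.neg_apply, map_mul, ← fourier_neg]
    rfl
  · rw [map_smulₛₗ, adjoint_shiftProj]

section Subtraction

variable {ι : Type*} [DecidableEq (ι → ℤ)]

theorem summable_norm_sub_single {ρ : (ι → ℤ) → ℂ} (hρ : Summable fun η => ‖ρ η‖) (z : ℂ) :
    Summable fun η => ‖(ρ - Pi.single 0 z : (ι → ℤ) → ℂ) η‖ := by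
  have hs : Summable fun η : ι → ℤ => ‖(Pi.single 0 z : (ι → ℤ) → ℂ) η‖ :=
    summable_of_ne_finset_zero (s := {0}) fun η hη => by
      rw [Pi.single_eq_of_ne (by simpa using hη), norm_zero]
  exact .of_nonneg_of_le (fun _ => norm_nonneg _) (fun η => norm_sub_le _ _) (hρ.add hs)

theorem hamiltonian_sub_single {E : Set (ι → ℤ)} {ρ ς : (ι → ℤ) → ℂ}
    (hρ : Summable fun η => ‖ρ η‖) (hς : Summable fun η => ‖ς η‖) (z : ℂ) :
    hamiltonian E (ρ - Pi.single 0 z) ς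
      = hamiltonian E ρ ς - z • ContinuousLinearMap.id ℂ _ := by
  have hs : HasSum (fun η : ι → ℤ => (Pi.single 0 z : (ι → ℤ) → ℂ) η • shift E η)
      (z • ContinuousLinearMap.id ℂ _) := by
    convert! hasSum_single (f := fun η : ι → ℤ => (Pi.single 0 z : (ι → ℤ) → ℂ) η • shift E η) 0
      fun η hη => ?_ using 1
    · rw [Pi.single_eq_same, shift_zero]
    · rw [Pi.single_eq_of_ne hη, zero_smul]
  refine HasSum.tsum_eq ?_
  convert! (summable_hamTerm E hρ hς).hasSum.sub hs using 2 with η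
  rw [hamTerm, hamTerm, Pi.sub_apply, sub_smul]
  abel

theorem symbol_sub_single (j : ι) (τ : UnitAddCircle) {ρ ς : (ι → ℤ) → ℂ}
    (hρ : Summable fun η => ‖ρ η‖) (hς : Summable fun η => ‖ς η‖) (z : ℂ) :
    symbol j τ (ρ - Pi.single 0 z) ς = symbol j τ ρ ς - z • ContinuousLinearMap.id ℂ _ := by
  have hs : HasSum (fun η : ι → ℤ => (fourier (-(η j)) τ * (Pi.single 0 z : (ι → ℤ) → ℂ) η)
      • shift (posOrthant {i // i ≠ j}) (dropCoord j η)) (z • ContinuousLinearMap.id ℂ _) := by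
    convert! hasSum_single (f := fun η : ι → ℤ =>
      (fourier (-(η j)) τ * (Pi.single 0 z : (ι → ℤ) → ℂ) η)
        • shift (posOrthant {i // i ≠ j}) (dropCoord j η)) 0 fun η hη => ?_ using 1
    · rw [Pi.single_eq_same, show dropCoord j (0 : ι → ℤ) = 0 from rfl, shift_zero, Pi.zero_apply,
        neg_zero, fourier_zero, one_mul]
    · rw [Pi.single_eq_of_ne hη, mul_zero, zero_smul]
  have hsum : Summable (symbolTerm j τ ρ ς) :=
    .of_norm_bounded (hρ.add hς) (norm_symbolTerm_le j τ ρ ς)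
  refine HasSum.tsum_eq ?_
  convert! hsum.hasSum.sub hs using 2 with η
  rw [symbolTerm, symbolTerm, Pi.sub_apply, mul_sub, sub_smul]
  abel

end Subtraction

variable {ι : Type*} [Fintype ι] [DecidableEq ι]

/-- The operator `T_ρ + V_ς` is Fredholm if and only if all its symbols are invertible. -/
theorem isFredholm_hamiltonian_iff {ρ ς : (ι → ℤ) → ℂ} (hρ : Summable fun η => ‖ρ η‖)
    (hς : Summable fun η => ‖ς η‖) :
    (hamiltonian (posOrthant ι) ρ ς).IsFredholm ↔ ∀ j τ, IsUnit (symbol j τ ρ ς) := by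
  rw [isFredholm_iff_isBoundedBelowAtInfinity, adjoint_hamiltonian _ hρ hς,
    isBoundedBelowAtInfinity_hamiltonian_iff hρ hς,
    isBoundedBelowAtInfinity_hamiltonian_iff (summable_norm_conjNeg hρ)
      (by simpa only [RCLike.norm_conj] using hς)]
  simp only [isUnit_iff_isBoundedBelow, adjoint_symbol _ _ hρ hς, forall_and]

theorem essentialSpectrum_hamiltonian {ρ ς : (ι → ℤ) → ℂ} (hρ : Summable fun η => ‖ρ η‖)
    (hς : Summable fun η => ‖ς η‖) :
    essentialSpectrum (hamiltonian (posOrthant ι) ρ ς)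
      = ⋃ j : ι, ⋃ τ : UnitAddCircle, spectrum ℂ (symbol j τ ρ ς) := by
  ext z
  rw [essentialSpectrum, Set.mem_ofPred_eq, ← hamiltonian_sub_single hρ hς,
    isFredholm_hamiltonian_iff (summable_norm_sub_single hρ z) hς]
  simp only [Set.mem_iUnion, not_forall, symbol_sub_single _ _ hρ hς]
  refine exists_congr fun j => exists_congr fun τ => ?_
  rw [spectrum.mem_iff, ← IsUnit.neg_iff, neg_sub]
  rfl

end Fredholm

/-! ### Fiber Hamiltonians -/

section Fiber

open ContinuousLinearMap

/-- Splitting off the `j`-th coordinate of `ℤ^ι`, as the last component. -/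
def insertCoordEquiv {ι : Type*} [DecidableEq ι] (j : ι) :
    (({i // i ≠ j} → ℤ) × ℤ) ≃ (ι → ℤ) where
  toFun p := insertCoord j p.2 p.1
  invFun η := (dropCoord j η, η j)
  left_inv p := by simp
  right_inv η := by simp

/-- Summing over one coordinate in the coefficients and over the others in the series is summing
over all of `ℤ^ι`. -/
theorem tsum_tsum_smul_eq {ι Y : Type*} [DecidableEq ι] [NormedAddCommGroup Y] [NormedSpace ℂ Y]
    [CompleteSpace Y] (j : ι) {c : (ι → ℤ) → ℂ} (hc : Summable fun η => ‖c η‖)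
    {v : ({i // i ≠ j} → ℤ) → Y} (hv : ∀ z, ‖v z‖ ≤ 1) :
    ∑' z, (∑' y : ℤ, c (insertCoord j y z)) • v z = ∑' η, c η • v (dropCoord j η) := by
  have hs : Summable fun η => c η • v (dropCoord j η) := by
    refine .of_norm_bounded hc fun η => ?_
    rw [norm_smul]
    exact mul_le_of_le_one_right (norm_nonneg _) (hv _)
  have hs' : Summable fun p : ({i // i ≠ j} → ℤ) × ℤ => c (insertCoord j p.2 p.1) • v p.1 := by
    refine ((insertCoordEquiv j).summable_iff.2 hs).congr fun p => ?_
    simp [insertCoordEquiv]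
  have hc' : Summable fun p : ({i // i ≠ j} → ℤ) × ℤ => c (insertCoord j p.2 p.1) :=
    (insertCoordEquiv j).summable_iff.2 hc.of_norm
  rw [← (insertCoordEquiv j).tsum_eq]
  simp only [insertCoordEquiv, Equiv.coe_fn_mk, dropCoord_insertCoord]
  rw [hs'.tsum_prod]
  exact tsum_congr fun z => ((hc'.prod_factor z).tsum_smul_const _).symm

theorem toeplitz_nu_add_potential_nu {n : ℕ} (j : Fin n) (τ : UnitAddCircle)
    {ρ ς : (Fin n → ℤ) → ℂ} (hρ : Summable fun η => ‖ρ η‖) (hς : Summable fun η => ‖ς η‖) :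
    toeplitz (posOrthant {i : Fin n // i ≠ j}) (nu j τ ρ)
      + potential (posOrthant {i : Fin n // i ≠ j}) (nu j 0 ς) = symbol j τ ρ ς := by
  have hρ' : Summable fun η : Fin n → ℤ => ‖(fourier (-(η j)) τ * ρ η : ℂ)‖ := by
    simpa only [norm_mul, norm_fourier_apply, one_mul] using hρ
  have h1 := tsum_tsum_smul_eq j hρ' (v := shift (posOrthant {i : Fin n // i ≠ j}))
    norm_shift_le
  have h2 := tsum_tsum_smul_eq j hς (v := shiftProj (posOrthant {i : Fin n // i ≠ j}))
    norm_shiftProj_le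
  have h3 : toeplitz (posOrthant {i : Fin n // i ≠ j}) (nu j τ ρ)
      = ∑' η : Fin n → ℤ, (fourier (-(η j)) τ * ρ η : ℂ)
          • shift (posOrthant {i : Fin n // i ≠ j}) (dropCoord j η) := by
    rw [← h1]
    refine tsum_congr fun z => ?_
    simp only [insertCoord_self]
    rfl
  have h4 : potential (posOrthant {i : Fin n // i ≠ j}) (nu j 0 ς)
      = ∑' η : Fin n → ℤ, ς η • shiftProj (posOrthant {i : Fin n // i ≠ j}) (dropCoord j η) := by
    rw [← h2]
    refine tsum_congr fun z => ?_
    simp only [nu, fourier_eval_zero, one_mul]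
    rfl
  rw [h3, h4]
  refine (Summable.tsum_add (.of_norm_bounded hρ' fun η => ?_)
    (.of_norm_bounded hς fun η => ?_)).symm
  · rw [norm_smul]
    exact mul_le_of_le_one_right (norm_nonneg _) (norm_shift_le _)
  · rw [norm_smul]
    exact mul_le_of_le_one_right (norm_nonneg _) (norm_shiftProj_le _)

theorem thetaInv_injective (N : ℕ) : Function.Injective (thetaInv (N := N)) := by
  intro z w h
  funext k
  induction k using WellFoundedLT.induction with
  | ind k ih =>
    have hk := congrFun h k
    simp only [thetaInv] at hk
    rw [← Finset.Iio_insert, Finset.sum_insert (by simp), Finset.sum_insert (by simp),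
      Finset.sum_congr rfl fun i hi => ih i (Finset.mem_Iio.1 hi)] at hk
    exact add_right_cancel hk

theorem summable_norm_mu {n : ℕ} (τ : UnitAddCircle) {ρ : (Fin (n + 1) → ℤ) → ℂ}
    (hρ : Summable fun x => ‖ρ x‖) : Summable fun z => ‖mu τ ρ z‖ := by
  have hinj : Function.Injective fun p : (Fin n → ℤ) × ℤ => thetaInv (Fin.cons p.2 p.1) := by
    intro p q h
    have := Fin.cons_injective2 (thetaInv_injective _ h)
    exact Prod.ext this.2 this.1
  have hs : Summable fun p : (Fin n → ℤ) × ℤ => ‖ρ (thetaInv (Fin.cons p.2 p.1))‖ :=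
    hρ.comp_injective hinj
  refine .of_nonneg_of_le (fun _ => norm_nonneg _) (fun z => ?_) hs.prod
  exact tsum_of_norm_bounded (hs.prod_factor z).hasSum fun y => by
    rw [norm_mul, norm_fourier_apply, one_mul]

theorem summable_norm_ofReal_of_memℓp {X : Type*} {φ : X → ℝ} (hφ : Memℓp φ 1) :
    Summable fun x => ‖(φ x : ℂ)‖ := by
  have := (memℓp_gen_iff (p := 1) (by norm_num)).1 hφ
  simpa using this

theorem essentialSpectrum_fiber {n : ℕ} {φ ψ : (Fin (n + 1) → ℤ) → ℝ} (hφ : Memℓp φ 1)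
    (hψ : Memℓp ψ 1) (τ : UnitAddCircle) :
    essentialSpectrum (fiber φ ψ τ)
      = ⋃ j : Fin n, ⋃ τ' : UnitAddCircle, reducedSpectrum φ ψ j τ τ' := by
  have h1 := summable_norm_mu τ (summable_norm_ofReal_of_memℓp hφ)
  have h2 := summable_norm_mu 0 (summable_norm_ofReal_of_memℓp hψ)
  rw [fiber, ← hamiltonian_eq_toeplitz_add_potential _ h1 h2, essentialSpectrum_hamiltonian h1 h2]
  simp only [reducedSpectrum, reducedFiber, toeplitz_nu_add_potential_nu _ _ h1 h2]

end Fiber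

/-! ### The Heisenberg case for two magnons -/

section Heisenberg

/-- For an empty index type, `ℓ²((ℕ*)^ι)` is one-dimensional and the operator is a scalar. -/
theorem spectrum_toeplitz_add_potential_of_isEmpty {ι : Type*} [IsEmpty ι] (ρ ς : (ι → ℤ) → ℂ) :
    spectrum ℂ (toeplitz (posOrthant ι) ρ + potential (posOrthant ι) ς) = {ρ 0 + ς 0} := by
  have hshift : ∀ η : ι → ℤ, shift (posOrthant ι) η = 1 := fun η => by
    rw [Subsingleton.elim η 0, shift_zero]
    rfl
  have h1 : toeplitz (posOrthant ι) ρ = ρ 0 • 1 := by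
    rw [toeplitz, tsum_eq_single 0 fun η hη => absurd (Subsingleton.elim η 0) hη, hshift]
  have h2 : potential (posOrthant ι) ς = ς 0 • 1 := by
    rw [potential, tsum_eq_single 0 fun η hη => absurd (Subsingleton.elim η 0) hη,
      adjoint_shift, hshift, hshift]
    rfl
  have hnt : Nontrivial (lp (fun _ : posOrthant ι => ℂ) 2) := by
    classical
    refine ⟨lp.single 2 ⟨0, fun i => isEmptyElim i⟩ 1, 0, fun h => ?_⟩
    have := congrArg (fun f : lp (fun _ : posOrthant ι => ℂ) 2 => ‖f‖) h
    simp [lp.norm_single] at this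
  rw [h1, h2, ← add_smul, ← Algebra.algebraMap_eq_smul_one, spectrum.scalar_eq]

/-- The points of `S` in the coordinates `(x, z)` with `θ⁻¹(x, z) = (x, x + z)`. -/
theorem thetaInv_cons_mem_generators_iff (x : ℤ) (z : Fin 1 → ℤ) :
    thetaInv (Fin.cons x z) ∈ generators 2
      ↔ z 0 = -1 ∧ (x = 0 ∨ x = 1) ∨ z 0 = 1 ∧ (x = 0 ∨ x = -1) := by
  have h0 : thetaInv (Fin.cons x z : Fin 2 → ℤ) 0 = x := by
    have : Finset.Iic (0 : Fin 2) = {0} := by decide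
    simp [thetaInv, this]
  have h1 : thetaInv (Fin.cons x z : Fin 2 → ℤ) 1 = x + z 0 := by
    have : Finset.Iic (1 : Fin 2) = {0, 1} := by decide
    simp only [thetaInv, this]
    rw [Finset.sum_pair (by decide)]
    rfl
  simp only [generators, Set.mem_ofPred_eq, Fin.exists_fin_two, funext_iff, Fin.forall_fin_two]
  erw [h0, h1]
  simp
  omega

/-- The function `μ(τ) (c χ_S)` for `N = 2`. -/
theorem mu_indicator_generators (c : ℂ) (τ : UnitAddCircle) (z : Fin 1 → ℤ) :
    mu τ (fun x => c * (generators 2).indicator (fun _ => 1) x) z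
      = if z 0 = -1 then c * (1 + fourier (-1) τ)
        else if z 0 = 1 then c * (1 + fourier 1 τ) else 0 := by
  classical
  rw [mu, tsum_eq_sum (s := {-1, 0, 1})]
  · simp only [Set.indicator_apply, thetaInv_cons_mem_generators_iff]
    by_cases h1 : z 0 = -1
    · simp [h1, -fourier_apply, fourier_zero]
      ring
    · by_cases h2 : z 0 = 1
      · simp [h2, -fourier_apply, fourier_zero]
        ring
      · simp [h1, h2]
  · intro x hx
    rw [Set.indicator_of_notMem, mul_zero, mul_zero]
    rw [thetaInv_cons_mem_generators_iff]
    simp at hx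
    tauto

theorem fourier_coe_eq_exp (n : ℤ) (x : ℝ) :
    (fourier n (x : UnitAddCircle) : ℂ) = Complex.exp (n * (2 * Real.pi * x) * Complex.I) := by
  rw [fourier_coe_apply]
  congr 1
  push_cast
  ring

theorem nu_mu_indicator_generators (c : ℂ) (τ τ' : ℝ) (j : Fin 1) (z : {i : Fin 1 // i ≠ j} → ℤ) :
    nu j (τ' : UnitAddCircle) (mu (τ : UnitAddCircle)
        fun x => c * (generators 2).indicator (fun _ => 1) x) z
      = c * (2 * Real.cos (2 * Real.pi * τ') + 2 * Real.cos (2 * Real.pi * (τ - τ')) : ℝ) := by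
  have hj : j = 0 := Subsingleton.elim _ _
  subst hj
  rw [nu, tsum_eq_sum (s := {-1, 1})]
  · rw [Finset.sum_pair (by decide), mu_indicator_generators, mu_indicator_generators]
    simp only [dif_pos, if_true, neg_neg]
    rw [if_neg (by decide)]
    simp only [fourier_coe_eq_exp]
    push_cast
    rw [Complex.two_cos, Complex.two_cos,
      show (2 : ℂ) * Real.pi * (τ - τ') * Complex.I
        = 2 * Real.pi * τ * Complex.I + -(2 * Real.pi * τ' * Complex.I) by ring,
      show -((2 : ℂ) * Real.pi * (τ - τ')) * Complex.I
        = -(2 * Real.pi * τ * Complex.I) + 2 * Real.pi * τ' * Complex.I by ring,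
      Complex.exp_add, Complex.exp_add]
    simp only [one_mul, neg_mul]
    ring
  · intro y hy
    simp at hy
    rw [mu_indicator_generators]
    simp [hy]

theorem setOf_cos_add_cos_eq_Icc (a b τ : ℝ) :
    {E : ℝ | ∃ τ' ∈ Set.Icc (0 : ℝ) 1,
        E = 8 * b - 4 * a * Real.cos (2 * Real.pi * τ')
          - 4 * a * Real.cos (2 * Real.pi * (τ - τ'))}
      = Set.Icc (8 * b - 8 * |a * Real.cos (Real.pi * τ)|)
          (8 * b + 8 * |a * Real.cos (Real.pi * τ)|) := by
  have hcos : ∀ τ' : ℝ, 8 * b - 4 * a * Real.cos (2 * Real.pi * τ')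
      - 4 * a * Real.cos (2 * Real.pi * (τ - τ'))
      = 8 * b - 8 * (a * Real.cos (Real.pi * τ)) * Real.cos (2 * Real.pi * τ' - Real.pi * τ) := by
    intro τ'
    have := Real.cos_add_cos (2 * Real.pi * τ') (2 * Real.pi * (τ - τ'))
    rw [show (2 * Real.pi * τ' + 2 * Real.pi * (τ - τ')) / 2 = Real.pi * τ by ring,
      show (2 * Real.pi * τ' - 2 * Real.pi * (τ - τ')) / 2 = 2 * Real.pi * τ' - Real.pi * τ by ring]
      at this
    linear_combination (-4 * a) * this
  simp only [hcos]
  set K := a * Real.cos (Real.pi * τ)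
  ext E
  simp only [Set.mem_ofPred_eq]
  constructor
  · rintro ⟨τ', _, rfl⟩
    have h1 : |K * Real.cos (2 * Real.pi * τ' - Real.pi * τ)| ≤ |K| := by
      rw [abs_mul]
      exact mul_le_of_le_one_right (abs_nonneg _) (Real.abs_cos_le_one _)
    have h2 := abs_le.1 h1
    constructor <;> linarith
  · rintro ⟨h1, h2⟩
    by_cases hK : K = 0
    · rw [hK, abs_zero] at h1 h2
      exact ⟨0, by simp, by rw [hK]; linarith⟩
    · set s := (8 * b - E) / (8 * K)
      have hs : |s| ≤ 1 := by
        rw [abs_div, div_le_one (by positivity), abs_mul, abs_of_pos (by norm_num : (0 : ℝ) < 8),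
          abs_le]
        constructor <;> linarith
      have hs' := abs_le.1 hs
      set t := (Real.arccos s + Real.pi * τ) / (2 * Real.pi)
      refine ⟨Int.fract t, ⟨Int.fract_nonneg t, (Int.fract_lt_one t).le⟩, ?_⟩
      have h3 : 2 * Real.pi * Int.fract t - Real.pi * τ
          = Real.arccos s - ⌊t⌋ * (2 * Real.pi) := by
        have : 2 * Real.pi * t = Real.arccos s + Real.pi * τ := by
          have := Real.pi_pos
          simp only [t]
          field_simp
        rw [Int.fract]
        linarith
      rw [h3, Real.cos_sub_int_mul_two_pi, Real.cos_arccos hs'.1 hs'.2]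
      simp only [s]
      field_simp
      ring

theorem memℓp_indicator_generators (c : ℝ) (N : ℕ) :
    Memℓp (fun x => c * (generators N).indicator (fun _ => (1 : ℝ)) x) 1 := by
  have hfin : (generators N).Finite := by
    refine ((Set.finite_range fun i : Fin N => (Pi.single i 1 : Fin N → ℤ)).union
      (Set.finite_range fun i : Fin N => (Pi.single i (-1) : Fin N → ℤ))).subset ?_
    rintro x ⟨i, rfl | rfl⟩
    · exact Or.inl ⟨i, rfl⟩
    · exact Or.inr ⟨i, rfl⟩
  refine (memℓp_gen_iff (by norm_num)).2 (summable_of_ne_finset_zero (s := hfin.toFinset) ?_)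
  intro x hx
  rw [Set.indicator_of_notMem (by simpa using hx)]
  simp

theorem essentialSpectrum_fiber_heisenberg (a b τ : ℝ) :
    essentialSpectrum
        (fiber (n := 1)
          (fun x => -2 * a * (generators 2).indicator (fun _ => 1) x)
          (fun x => 2 * b * (generators 2).indicator (fun _ => 1) x)
          (τ : UnitAddCircle))
      = Complex.ofReal '' {E : ℝ | ∃ τ' ∈ Set.Icc (0 : ℝ) 1,
          E = 8 * b - 4 * a * Real.cos (2 * Real.pi * τ')
            - 4 * a * Real.cos (2 * Real.pi * (τ - τ'))} := by
  rw [essentialSpectrum_fiber (memℓp_indicator_generators _ 2) (memℓp_indicator_generators _ 2)]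
  have hcoe : ∀ c : ℝ, (fun x => ((c * (generators 2).indicator (fun _ => (1 : ℝ)) x : ℝ) : ℂ))
      = fun x => (c : ℂ) * (generators 2).indicator (fun _ => (1 : ℂ)) x := by
    intro c
    funext x
    by_cases hx : x ∈ generators 2 <;> simp [hx]
  have hred : ∀ (j : Fin 1) (τ' : ℝ), reducedSpectrum (n := 1)
      (fun x => -2 * a * (generators 2).indicator (fun _ => 1) x)
      (fun x => 2 * b * (generators 2).indicator (fun _ => 1) x) j (τ : UnitAddCircle)
      (τ' : UnitAddCircle) = {((8 * b - 4 * a * Real.cos (2 * Real.pi * τ')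
            - 4 * a * Real.cos (2 * Real.pi * (τ - τ')) : ℝ) : ℂ)} := by
    intro j τ'
    have : IsEmpty {i : Fin 1 // i ≠ j} := ⟨fun i => i.2 (Subsingleton.elim _ _)⟩
    have h0 := nu_mu_indicator_generators ((2 * b : ℝ) : ℂ) 0 0 j 0
    have h1 := nu_mu_indicator_generators ((-2 * a : ℝ) : ℂ) τ τ' j 0
    rw [reducedSpectrum, reducedFiber, spectrum_toeplitz_add_potential_of_isEmpty, hcoe, hcoe, h1]
    rw [QuotientAddGroup.mk_zero] at h0
    rw [h0, ← Complex.ofReal_mul, ← Complex.ofReal_mul, ← Complex.ofReal_add]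
    congr 2
    simp
    ring
  ext w
  simp only [Set.mem_iUnion, Set.mem_image, Set.mem_ofPred_eq]
  constructor
  · rintro ⟨j, t, ht⟩
    obtain ⟨τ', hτ', rfl⟩ : t ∈ ((↑) : ℝ → UnitAddCircle) '' Set.Icc (0 : ℝ) (0 + 1) := by
      rw [AddCircle.coe_image_Icc_eq]
      trivial
    rw [zero_add] at hτ'
    rw [hred] at ht
    exact ⟨_, ⟨τ', hτ', rfl⟩, ht.symm⟩
  · rintro ⟨E, ⟨τ', _, rfl⟩, rfl⟩
    exact ⟨0, τ', by rw [hred]; rfl⟩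

end Heisenberg

end MagnonToeplitz

end

theorem theorem4p2 :
    (∀ (n : ℕ) (φ ψ : (Fin (n + 1) → ℤ) → ℝ), Memℓp φ 1 → Memℓp ψ 1 → ∀ τ : UnitAddCircle,
      MagnonToeplitz.essentialSpectrum (MagnonToeplitz.fiber φ ψ τ)
        = ⋃ j : Fin n, ⋃ τ' : UnitAddCircle, MagnonToeplitz.reducedSpectrum φ ψ j τ τ') ∧
    (∀ a b τ : ℝ,
      MagnonToeplitz.essentialSpectrum
          (MagnonToeplitz.fiber (n := 1)
            (fun x => -2 * a * (MagnonToeplitz.generators 2).indicator (fun _ => 1) x)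
            (fun x => 2 * b * (MagnonToeplitz.generators 2).indicator (fun _ => 1) x)
            (τ : UnitAddCircle))
        = Complex.ofReal '' {E : ℝ | ∃ τ' ∈ Set.Icc (0 : ℝ) 1,
            E = 8 * b - 4 * a * Real.cos (2 * Real.pi * τ')
              - 4 * a * Real.cos (2 * Real.pi * (τ - τ'))} ∧
      {E : ℝ | ∃ τ' ∈ Set.Icc (0 : ℝ) 1,
            E = 8 * b - 4 * a * Real.cos (2 * Real.pi * τ')
              - 4 * a * Real.cos (2 * Real.pi * (τ - τ'))}
        = Set.Icc (8 * b - 8 * |a * Real.cos (Real.pi * τ)|)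
            (8 * b + 8 * |a * Real.cos (Real.pi * τ)|)) := by
  refine ⟨fun n φ ψ hφ hψ τ => MagnonToeplitz.essentialSpectrum_fiber hφ hψ τ, fun a b τ => ?_⟩
  exact ⟨MagnonToeplitz.essentialSpectrum_fiber_heisenberg a b τ,
    MagnonToeplitz.setOf_cos_add_cos_eq_Icc a b τ⟩
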